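/- Let $k$ be a commutative ring and let $A$, $B$ be (associative, unital) $k$-algebras. Let $\mathfrak D$ be a $B$-coring with comultiplication $\Delta$ and counit $\varepsilon$, let $\mathfrak C$ be an $A$-coring, and let $(\gamma,\alpha):(\mathfrak D:B)\to(\mathfrak C:A)$ be a morphism of corings, i.e. $\alpha:B\to A$ is a $k$-algebra map and $\gamma:\mathfrak D\to\mathfrak C$ is a $B$-bimodule map such that the induced map $A\otimes_B\mathfrak D\otimes_BA\to\mathfrak C$, $a\otimes d\otimes a'\mapsto a\gamma(d)a'$, is a morphism of $A$-corings. Here $A$ is a $B$-bimodule via $\alpha$, and $A_\alpha[\mathfrak D]=A\otimes_B\mathfrak D\otimes_BA$ is the $A$-coring with comultiplication $a\otimes d\otimes a'\mapsto\sum(a\otimes d_{(1)}\otimes1)\otimes_A(1\otimes d_{(2)}\otimes a')$ and counit $a\otimes d\otimes a'\mapsto a\,\alpha(\varepsilon(d))\,a'$. Write $\mathcal M^{\mathfrak D}$ for the category of right $\mathfrak D$-comodules and colinear maps, and similarly for $A_\alpha[\mathfrak D]$. Let ${\bf Desc}_{(\gamma,\alpha)}$ be the category whose objects are pairs $(X,\rho)$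 of a right $A$-module $X$ (also regarded as a right $B$-module via $\alpha$) and a right $A$-linear map $\rho:X\to X\otimes_B\mathfrak D\otimes_BA$ such that - the composite $X\xrightarrow{\rho}X\otimes_B\mathfrak D\otimes_BA\to X$ with $x\otimes d\otimes a\mapsto x\,\alpha(\varepsilon(d))\,a$ is the identity, and - $(\rho\otimes_B\mathfrak D\otimes_BA)\circ\rho=(X\otimes_B\mathfrak D\otimes_B\nu)\circ(X\otimes_B\Delta\otimes_BA)\circ\rho$ as maps $X\to X\otimes_B\mathfrak D\otimes_BA\otimes_B\mathfrak D\otimes_BA$, where $\nu:\mathfrak D\otimes_BA\to A\otimes_B\mathfrak D\otimes_BA$, $w\mapsto1\otimes w$; its morphisms $(X,\rho_X)\to(Z,\rho_Z)$ are the right $A$-linear maps $f:X\to Z$ with $\rho_Z\circ f=(f\otimes_B\mathfrak D\otimes_BA)\circ\rho_X$. Then: 1. The functor $\mathcal M^{A_\alpha[\mathfrak D]}\to{\bf Desc}_{(\gamma,\alpha)}$ that keeps the underlying right $A$-modules and maps and sends a coaction $\varrho^X:X\to X\otimes_AA_\alpha[\mathfrak D]$ to its composite with the canonical isomorphism $X\otimes_A(A\otimes_B\mathfrak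 D\otimes_BA)\simeq X\otimes_B\mathfrak D\otimes_BA$ is an isomorphism of categories. In particular ${\bf Desc}_{(\gamma,\alpha)}$ is isomorphic to $\mathcal M^{A_\alpha[\mathfrak D]}$. 2. If $\mathfrak D$ is flat as a left $B$-module and $A$ is faithfully flat as a left $B$-module (via $\alpha$), then the functor $-\otimes_BA:\mathcal M^{\mathfrak D}\to\mathcal M^{A_\alpha[\mathfrak D]}$, where $M\otimes_BA$ has the coaction $m\otimes a\mapsto\sum(m_{(0)}\otimes1)\otimes_A(1\otimes m_{(1)}\otimes a)$, is an equivalence of categories; hence so is its composite $-\otimes_BA:\mathcal M^{\mathfrak D}\to{\bf Desc}_{(\gamma,\alpha)}$ with the isomorphism in 1. -/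

import Mathlib

open CategoryTheory MulOpposite

universe w u v

namespace CoringDescent

/-! ### Tensor products over a noncommutative ring, along restriction of scalars

Right `R`-modules are `Module Rᵐᵒᵖ M`; an `(R, S)`-bimodule is an abelian group with
`Module R M`, `Module Sᵐᵒᵖ M` and `SMulCommClass R Sᵐᵒᵖ M`. -/

section Tens

variable {B R S P Q : Type*} [Ring B] [Ring R] [Ring S] [Ring P] [Ring Q]

/-- The tensor product `M ⊗_B N` of a right `R`-module `M` and a left `S`-module `N`, both
regarded as `B`-modules by restriction of scalars along `f : B →+* R` and `g : B →+* S`: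
the quotient of `M ⊗_ℤ N` by the relations `m·b ⊗ n = m ⊗ b·n`. -/
def Tens (f : B →+* R) (g : B →+* S) (M N : Type*) [AddCommGroup M] [Module Rᵐᵒᵖ M]
    [AddCommGroup N] [Module S N] : Type _ :=
  TensorProduct ℤ M N ⧸ AddSubgroup.closure
    {t : TensorProduct ℤ M N | ∃ (b : B) (m : M) (n : N),
      t = TensorProduct.tmul ℤ (op (f b) • m) n - TensorProduct.tmul ℤ m (g b • n)}

namespace Tens

variable (f : B →+* R) (g : B →+* S)
variable {M N K : Type*} [AddCommGroup M] [Module Rᵐᵒᵖ M] [AddCommGroup N] [Module S N]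
  [AddCommGroup K]

instance : AddCommGroup (Tens f g M N) :=
  inferInstanceAs (AddCommGroup (TensorProduct ℤ M N ⧸ AddSubgroup.closure _))

/-- The pure tensor `m ⊗ n`. -/
def tmul (m : M) (n : N) : Tens f g M N :=
  QuotientAddGroup.mk (TensorProduct.tmul ℤ m n)

variable {f g}

theorem add_tmul (m m' : M) (n : N) : tmul f g (m + m') n = tmul f g m n + tmul f g m' n := by
  unfold tmul; rw [TensorProduct.add_tmul]; rfl

theorem tmul_add (m : M) (n n' : N) : tmul f g m (n + n') = tmul f g m n + tmul f g m n' := by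
  unfold tmul; rw [TensorProduct.tmul_add]; rfl

theorem smul_tmul (b : B) (m : M) (n : N) :
    tmul f g (op (f b) • m) n = tmul f g m (g b • n) := by
  refine sub_eq_zero.1 ?_
  exact (QuotientAddGroup.eq_zero_iff _).2 (AddSubgroup.subset_closure ⟨b, m, n, rfl⟩)

@[elab_as_elim]
theorem induction_on {p : Tens f g M N → Prop} (t : Tens f g M N)
    (pure : ∀ m n, p (tmul f g m n)) (add : ∀ x y, p x → p y → p (x + y)) : p t := by
  obtain ⟨t, rfl⟩ := QuotientAddGroup.mk_surjective t
  induction t using TensorProduct.induction_on with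
  | zero =>
    have h := pure 0 0
    unfold tmul at h
    rwa [TensorProduct.tmul_zero] at h
  | tmul m n => exact pure m n
  | add x y hx hy => exact add _ _ hx hy

/-- The universal property: a biadditive map `F` that is balanced over `B` factors through
`M ⊗_B N`. -/
def lift (F : M → N → K) (h1 : ∀ m m' n, F (m + m') n = F m n + F m' n)
    (h2 : ∀ m n n', F m (n + n') = F m n + F m n')
    (hb : ∀ b m n, F (op (f b) • m) n = F m (g b • n)) : Tens f g M N →+ K :=
  QuotientAddGroup.lift _
    (TensorProduct.liftAddHom (R := ℤ)
      (AddMonoidHom.mk' (fun m => AddMonoidHom.mk' (F m) (h2 m))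
        (fun m m' => AddMonoidHom.ext fun n => h1 m m' n))
      (fun r m n => by
        rw [map_zsmul, map_zsmul]; rfl))
    ((AddSubgroup.closure_le _).2 (by
      rintro _ ⟨b, m, n, rfl⟩
      change _ = _
      rw [map_sub, sub_eq_zero]
      exact hb b m n))

@[simp] theorem lift_tmul (F : M → N → K) (h1 h2 hb) (m : M) (n : N) :
    lift (f := f) (g := g) F h1 h2 hb (tmul f g m n) = F m n := rfl

theorem hom_ext {φ ψ : Tens f g M N →+ K}
    (h : ∀ m n, φ (tmul f g m n) = ψ (tmul f g m n)) : φ = ψ := by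
  ext t
  induction t using Tens.induction_on with
  | pure m n => exact h m n
  | add x y hx hy => rw [map_add, map_add, hx, hy]

section left

variable [Module P M] [SMulCommClass P Rᵐᵒᵖ M]

/-- The left action on a tensor product inherited from its left factor. -/
instance (priority := 200) leftModule : Module P (Tens f g M N) where
  smul p := lift (fun m n => tmul f g (p • m) n)
    (fun m m' n => by rw [smul_add, add_tmul]) (fun m n n' => tmul_add _ _ _)
    (fun b m n => by rw [smul_comm, smul_tmul])
  one_smul t := by
    induction t using Tens.induction_on with
    | pure m n => exact congrArg (fun x => tmul f g x n) (one_smul P m)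
    | add x y hx hy => exact (map_add _ x y).trans (congrArg₂ _ hx hy)
  mul_smul p p' t := by
    induction t using Tens.induction_on with
    | pure m n => exact congrArg (fun x => tmul f g x n) (mul_smul p p' m)
    | add x y hx hy =>
      refine (map_add _ x y).trans ((congrArg₂ _ hx hy).trans ?_)
      refine (map_add _ _ _).symm.trans (congrArg _ (map_add _ x y).symm)
  smul_zero p := map_zero _
  smul_add p x y := map_add _ x y
  add_smul p p' t := by
    induction t using Tens.induction_on with
    | pure m n =>
      exact (congrArg (fun x => tmul f g x n) (add_smul p p' m)).trans (add_tmul _ _ _)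
    | add x y hx hy =>
      refine (map_add _ x y).trans ((congrArg₂ _ hx hy).trans ?_)
      refine (add_add_add_comm _ _ _ _).trans ?_
      exact congrArg₂ _ (map_add _ x y).symm (map_add _ x y).symm
  zero_smul t := by
    induction t using Tens.induction_on with
    | pure m n =>
      have h : tmul f g (0 : M) n = 0 := by
        have := add_tmul (f := f) (g := g) (0 : M) 0 n
        rw [add_zero] at this
        exact left_eq_add.1 this
      exact (congrArg (fun x => tmul f g x n) (zero_smul P m)).trans h
    | add x y hx hy =>
      exact (map_add _ x y).trans ((congrArg₂ _ hx hy).trans (add_zero _))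

@[simp] theorem smul_left (p : P) (m : M) (n : N) : p • tmul f g m n = tmul f g (p • m) n := rfl

end left

section right

variable [Module Qᵐᵒᵖ N] [SMulCommClass S Qᵐᵒᵖ N]

/-- The right action on a tensor product inherited from its right factor. -/
instance (priority := 200) rightModule : Module Qᵐᵒᵖ (Tens f g M N) where
  smul q := lift (fun m n => tmul f g m (q • n))
    (fun m m' n => add_tmul _ _ _) (fun m n n' => by rw [smul_add, tmul_add])
    (fun b m n => by rw [smul_tmul, smul_comm])
  one_smul t := by
    induction t using Tens.induction_on with
    | pure m n => exact congrArg (fun x => tmul f g m x) (one_smul Qᵐᵒᵖ n)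
    | add x y hx hy => exact (map_add _ x y).trans (congrArg₂ _ hx hy)
  mul_smul p p' t := by
    induction t using Tens.induction_on with
    | pure m n => exact congrArg (fun x => tmul f g m x) (mul_smul p p' n)
    | add x y hx hy =>
      refine (map_add _ x y).trans ((congrArg₂ _ hx hy).trans ?_)
      refine (map_add _ _ _).symm.trans (congrArg _ (map_add _ x y).symm)
  smul_zero p := map_zero _
  smul_add p x y := map_add _ x y
  add_smul p p' t := by
    induction t using Tens.induction_on with
    | pure m n =>
      exact (congrArg (fun x => tmul f g m x) (add_smul p p' n)).trans (tmul_add _ _ _)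
    | add x y hx hy =>
      refine (map_add _ x y).trans ((congrArg₂ _ hx hy).trans ?_)
      refine (add_add_add_comm _ _ _ _).trans ?_
      exact congrArg₂ _ (map_add _ x y).symm (map_add _ x y).symm
  zero_smul t := by
    induction t using Tens.induction_on with
    | pure m n =>
      have h : tmul f g m (0 : N) = 0 := by
        have := tmul_add (f := f) (g := g) m (0 : N) 0
        rw [add_zero] at this
        exact left_eq_add.1 this
      exact (congrArg (fun x => tmul f g m x) (zero_smul Qᵐᵒᵖ n)).trans h
    | add x y hx hy =>
      exact (map_add _ x y).trans ((congrArg₂ _ hx hy).trans (add_zero _))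

@[simp] theorem smul_right (q : Q) (m : M) (n : N) :
    op q • tmul f g m n = tmul f g m (op q • n) := rfl

end right

instance [Module P M] [SMulCommClass P Rᵐᵒᵖ M] [Module Qᵐᵒᵖ N] [SMulCommClass S Qᵐᵒᵖ N] :
    SMulCommClass P Qᵐᵒᵖ (Tens f g M N) where
  smul_comm p q t := by
    induction t using Tens.induction_on with
    | pure m n => rfl
    | add x y hx hy => simp only [smul_add, hx, hy]

section maps

variable {R' S' : Type*} [Ring R'] [Ring S'] {f' : B →+* R'} {g' : B →+* S'}
  {M' N' : Type*} [AddCommGroup M'] [Module R'ᵐᵒᵖ M'] [AddCommGroup N'] [Module S' N']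

/-- `φ ⊗_B ψ` for a right `B`-linear map `φ` and a left `B`-linear map `ψ`. -/
def map (φ : M →+ M') (ψ : N →+ N') (hφ : ∀ b m, φ (op (f b) • m) = op (f' b) • φ m)
    (hψ : ∀ b n, ψ (g b • n) = g' b • ψ n) : Tens f g M N →+ Tens f' g' M' N' :=
  lift (fun m n => tmul f' g' (φ m) (ψ n)) (fun m m' n => by rw [map_add, add_tmul])
    (fun m n n' => by rw [map_add, tmul_add]) (fun b m n => by rw [hφ, hψ, smul_tmul])

@[simp] theorem map_tmul (φ : M →+ M') (ψ : N →+ N') (hφ hψ) (m : M) (n : N) :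
    map (f := f) (g := g) (f' := f') (g' := g') φ ψ hφ hψ (tmul f g m n) =
      tmul f' g' (φ m) (ψ n) := rfl

/-- `φ ⊗_B N` for a right `B`-linear map `φ`. -/
abbrev rTensor (N : Type*) [AddCommGroup N] [Module S N] (φ : M →+ M')
    (hφ : ∀ b m, φ (op (f b) • m) = op (f' b) • φ m) : Tens f g M N →+ Tens f' g M' N :=
  map φ (AddMonoidHom.id N) hφ (fun _ _ => rfl)

/-- `φ ⊗_B N` for a right `R`-linear map `φ`. -/
def rTensorLin (f : B →+* R) (g : B →+* S) {M M' : Type*} [AddCommGroup M] [Module Rᵐᵒᵖ M]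
    [AddCommGroup M'] [Module Rᵐᵒᵖ M'] (N : Type*) [AddCommGroup N] [Module S N]
    (φ : M →ₗ[Rᵐᵒᵖ] M') : Tens f g M N →+ Tens f g M' N :=
  rTensor N φ.toAddMonoidHom (fun b x => φ.map_smul (op (f b)) x)

@[simp] theorem rTensorLin_tmul {M M' : Type*} [AddCommGroup M] [Module Rᵐᵒᵖ M]
    [AddCommGroup M'] [Module Rᵐᵒᵖ M'] (φ : M →ₗ[Rᵐᵒᵖ] M') (m : M) (n : N) :
    rTensorLin f g N φ (tmul f g m n) = tmul f g (φ m) n := rfl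

/-- `M ⊗_B ψ` for a left `B`-linear map `ψ`. -/
abbrev lTensor (M : Type*) [AddCommGroup M] [Module Rᵐᵒᵖ M] (ψ : N →+ N')
    (hψ : ∀ b n, ψ (g b • n) = g' b • ψ n) : Tens f g M N →+ Tens f g' M N' :=
  map (AddMonoidHom.id M) ψ (fun _ _ => rfl) hψ

/-- The action isomorphism `B ⊗_B N ≃ N`, `b ⊗ n ↦ b·n`. -/
def unitLeft (g : B →+* S) (N : Type*) [AddCommGroup N] [Module S N] :
    Tens (RingHom.id B) g B N →+ N :=
  lift (fun b n => g b • n) (fun b b' n => by rw [map_add, add_smul])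
    (fun b n n' => smul_add _ _ _)
    (fun b c n => by
      rw [op_smul_eq_mul, map_mul, mul_smul]; rfl)

@[simp] theorem unitLeft_tmul (b : B) (n : N) :
    unitLeft g N (tmul (RingHom.id B) g b n) = g b • n := rfl

/-- The right multiplication `X ⊗_B R → X`, `x ⊗ r ↦ x·r`, for a right `R`-module `X` restricted
along `f : B →+* R`; the isomorphism `X ⊗_R R ≃ X` when `f` is the identity. -/
def mulRight (f : B →+* R) (X : Type*) [AddCommGroup X] [Module Rᵐᵒᵖ X] :
    Tens f f X R →+ X :=
  lift (fun x r => op r • x) (fun x y r => smul_add _ _ _)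
    (fun x r s => by rw [MulOpposite.op_add, add_smul])
    (fun b x r => by rw [smul_smul, ← op_mul, smul_eq_mul])

@[simp] theorem mulRight_tmul (x : M) (r : R) :
    mulRight f M (tmul f f x r) = op r • x := rfl

variable {C T U : Type*} [Ring C] [Ring T] [Ring U] {f₁ : C →+* T} {g₁ : C →+* U}
  [Module Tᵐᵒᵖ N] [SMulCommClass S Tᵐᵒᵖ N] [Module U K]

/-- The associativity isomorphism `(M ⊗_B N) ⊗_C K ≃ M ⊗_B (N ⊗_C K)`,
`(m ⊗ n) ⊗ k ↦ m ⊗ (n ⊗ k)`. -/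
def assoc (f : B →+* R) (g : B →+* S) (f₁ : C →+* T) (g₁ : C →+* U) (M N K : Type*)
    [AddCommGroup M] [Module Rᵐᵒᵖ M] [AddCommGroup N] [Module S N] [Module Tᵐᵒᵖ N]
    [SMulCommClass S Tᵐᵒᵖ N] [AddCommGroup K] [Module U K] :
    Tens f₁ g₁ (Tens f g M N) K →+ Tens f g M (Tens f₁ g₁ N K) :=
  lift
    (fun t k => lift (f := f) (g := g) (fun m n => tmul f g m (tmul f₁ g₁ n k))
      (fun m m' n => add_tmul _ _ _) (fun m n n' => by rw [add_tmul, tmul_add])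
      (fun b m n => by rw [smul_tmul, smul_left]) t)
    (fun t t' k => map_add _ _ _)
    (fun t k k' => by
      induction t using Tens.induction_on with
      | pure m n => simp only [lift_tmul, tmul_add]
      | add x y hx hy => simp only [map_add, hx, hy]; abel)
    (fun c t k => by
      induction t using Tens.induction_on with
      | pure m n => simp only [smul_right, lift_tmul, smul_tmul]
      | add x y hx hy => simp only [smul_add, map_add, hx, hy])

@[simp] theorem assoc_tmul (m : M) (n : N) (k : K) :
    assoc f g f₁ g₁ M N K (tmul f₁ g₁ (tmul f g m n) k) = tmul f g m (tmul f₁ g₁ n k) := rfl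

end maps

end Tens

end Tens

/-! ### Corings and their morphisms -/

/-- A bimodule map from the `B`-bimodule `D` to the `A`-bimodule `C` along `α : B →+* A`, i.e. a
`B`-bimodule map when `C` is restricted along `α`.  For `α` the identity these are the ordinary
bimodule maps. -/
structure BimodHom {A B : Type*} [Ring A] [Ring B] (α : B →+* A) (D C : Type*)
    [AddCommGroup D] [Module B D] [Module Bᵐᵒᵖ D] [AddCommGroup C] [Module A C]
    [Module Aᵐᵒᵖ C] where
  hom : D →+ C
  map_left : ∀ (b : B) (d : D), hom (b • d) = α b • hom d
  map_right : ∀ (b : B) (d : D), hom (op b • d) = op (α b) • hom d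

/-- A `B`-coring: a `B`-bimodule `D` with a coassociative comultiplication `D → D ⊗_B D` and a
two-sided counit `D → B`, both being bimodule maps. -/
structure Coring (B D : Type*) [Ring B] [AddCommGroup D] [Module B D] [Module Bᵐᵒᵖ D]
    [SMulCommClass B Bᵐᵒᵖ D] where
  comul : BimodHom (RingHom.id B) D (Tens (RingHom.id B) (RingHom.id B) D D)
  counit : BimodHom (RingHom.id B) D B
  coassoc : ∀ d, Tens.assoc _ _ _ _ D D D
      (Tens.rTensor (g := RingHom.id B) D comul.hom comul.map_right (comul.hom d)) =
    Tens.lTensor (f := RingHom.id B) D comul.hom comul.map_left (comul.hom d)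
  counit_left : ∀ d, Tens.unitLeft _ D
    (Tens.rTensor (g := RingHom.id B) D counit.hom counit.map_right
      (comul.hom d)) = d
  counit_right : ∀ d, Tens.mulRight _ D
    (Tens.lTensor (f := RingHom.id B) D counit.hom counit.map_left
      (comul.hom d)) = d

section BaseExt

variable {A B : Type*} [Ring A] [Ring B] (α : B →+* A)
  {D : Type*} [AddCommGroup D] [Module B D] [Module Bᵐᵒᵖ D] [SMulCommClass B Bᵐᵒᵖ D]

/-- The `A`-bimodule `A ⊗_B D ⊗_B A`, where `A` is a `B`-bimodule via `α`. -/
abbrev BaseExt (D : Type*) [AddCommGroup D] [Module B D] [Module Bᵐᵒᵖ D]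
    [SMulCommClass B Bᵐᵒᵖ D] : Type _ :=
  Tens α (RingHom.id B) A (Tens (RingHom.id B) α D A)

namespace BaseExt

/-- The element `a ⊗ d ⊗ a'`. -/
abbrev mk (a : A) (d : D) (a' : A) : BaseExt α D :=
  Tens.tmul α (RingHom.id B) a (Tens.tmul (RingHom.id B) α d a')

variable {α}

theorem mk_bal_left (a : A) (b : B) (d : D) (a' : A) :
    mk α (a * α b) d a' = mk α a (b • d) a' := by
  have := Tens.smul_tmul (f := α) (g := RingHom.id B) b a (Tens.tmul (RingHom.id B) α d a')
  simpa using this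

theorem mk_bal_right (a : A) (b : B) (d : D) (a' : A) :
    mk α a (op b • d) a' = mk α a d (α b * a') := by
  have := Tens.smul_tmul (f := RingHom.id B) (g := α) b d a'
  simp only [RingHom.id_apply, smul_eq_mul] at this
  simp only [mk, this]

theorem induction_on {p : BaseExt α D → Prop} (t : BaseExt α D)
    (pure : ∀ a d a', p (mk α a d a')) (add : ∀ x y, p x → p y → p (x + y)) : p t := by
  induction t using Tens.induction_on with
  | pure a s =>
    induction s using Tens.induction_on with
    | pure d a' => exact pure a d a'
    | add x y hx hy => rw [Tens.tmul_add]; exact add _ _ hx hy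
  | add x y hx hy => exact add _ _ hx hy

/-- A map out of `A ⊗_B D ⊗_B A`. -/
def lift {K : Type*} [AddCommGroup K] (F : A → D → A → K)
    (h1 : ∀ a₁ a₂ d a', F (a₁ + a₂) d a' = F a₁ d a' + F a₂ d a')
    (h2 : ∀ a d₁ d₂ a', F a (d₁ + d₂) a' = F a d₁ a' + F a d₂ a')
    (h3 : ∀ a d a₁ a₂, F a d (a₁ + a₂) = F a d a₁ + F a d a₂)
    (hl : ∀ a b d a', F (a * α b) d a' = F a (b • d) a')
    (hr : ∀ a b d a', F a (op b • d) a' = F a d (α b * a')) : BaseExt α D →+ K :=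
  Tens.lift
    (fun a t => Tens.lift (f := RingHom.id B) (g := α) (F a) (h2 a) (h3 a) (hr a) t)
    (fun a₁ a₂ t => by
      induction t using Tens.induction_on with
      | pure d a' => exact h1 a₁ a₂ d a'
      | add x y hx hy => simp only [map_add, hx, hy]; abel)
    (fun a x y => map_add _ x y)
    (fun b a t => by
      induction t using Tens.induction_on with
      | pure d a' => exact hl a b d a'
      | add x y hx hy => simp only [smul_add, map_add, hx, hy])

@[simp] theorem lift_mk {K : Type*} [AddCommGroup K] (F : A → D → A → K) (h1 h2 h3 hl hr)
    (a : A) (d : D) (a' : A) :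
    lift (α := α) F h1 h2 h3 hl hr (mk α a d a') = F a d a' := rfl

variable (α)

/-- The map `d₁ ⊗ d₂ ↦ (a ⊗ d₁ ⊗ 1) ⊗_A (1 ⊗ d₂ ⊗ a')`. -/
def split (a a' : A) : Tens (RingHom.id B) (RingHom.id B) D D →+
    Tens (RingHom.id A) (RingHom.id A) (BaseExt α D) (BaseExt α D) :=
  Tens.lift (fun d₁ d₂ => Tens.tmul _ _ (mk α a d₁ 1) (mk α 1 d₂ a'))
    (fun x y z => by rw [mk, Tens.add_tmul, Tens.tmul_add, Tens.add_tmul])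
    (fun x y z => by rw [mk, mk, Tens.add_tmul, Tens.tmul_add, Tens.tmul_add])
    (fun b x y => by
      have h1 : mk α a (op (RingHom.id B b) • x) 1
          = op (RingHom.id A (α b)) • mk α a x 1 := by
        rw [RingHom.id_apply, mk_bal_right]
        simp
      have h2 : mk α 1 (RingHom.id B b • y) a' = RingHom.id A (α b) • mk α 1 y a' := by
        rw [RingHom.id_apply, ← mk_bal_left]
        simp
      rw [h1, h2, Tens.smul_tmul])

@[simp] theorem split_tmul (a a' : A) (d₁ d₂ : D) :
    split α a a' (Tens.tmul _ _ d₁ d₂) = Tens.tmul _ _ (mk α a d₁ 1) (mk α 1 d₂ a') := rfl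

theorem split_add_left (a₁ a₂ a' : A) (t : Tens (RingHom.id B) (RingHom.id B) D D) :
    split α (a₁ + a₂) a' t = split α a₁ a' t + split α a₂ a' t := by
  induction t using Tens.induction_on with
  | pure d₁ d₂ => simp only [split_tmul, mk, Tens.add_tmul]
  | add x y hx hy => simp only [map_add, hx, hy]; abel

theorem split_add_right (a a₁ a₂ : A) (t : Tens (RingHom.id B) (RingHom.id B) D D) :
    split α a (a₁ + a₂) t = split α a a₁ t + split α a a₂ t := by
  induction t using Tens.induction_on with
  | pure d₁ d₂ => simp only [split_tmul, mk, Tens.tmul_add]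
  | add x y hx hy => simp only [map_add, hx, hy]; abel

theorem split_mul_left (a a' : A) (b : B) (t : Tens (RingHom.id B) (RingHom.id B) D D) :
    split α (a * α b) a' t = split α a a' (b • t) := by
  induction t using Tens.induction_on with
  | pure d₁ d₂ => simp only [split_tmul, Tens.smul_left, mk_bal_left]
  | add x y hx hy => simp only [smul_add, map_add, hx, hy]

theorem split_mul_right (a a' : A) (b : B) (t : Tens (RingHom.id B) (RingHom.id B) D D) :
    split α a a' (op b • t) = split α a (α b * a') t := by
  induction t using Tens.induction_on with
  | pure d₁ d₂ => simp only [split_tmul, Tens.smul_right, mk_bal_right]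
  | add x y hx hy => simp only [smul_add, map_add, hx, hy]

theorem smul_split (p a a' : A) (t : Tens (RingHom.id B) (RingHom.id B) D D) :
    p • split α a a' t = split α (p * a) a' t := by
  induction t using Tens.induction_on with
  | pure d₁ d₂ => simp only [split_tmul, Tens.smul_left, smul_eq_mul]
  | add x y hx hy => simp only [smul_add, map_add, hx, hy]

theorem op_smul_split (p a a' : A) (t : Tens (RingHom.id B) (RingHom.id B) D D) :
    op p • split α a a' t = split α a (a' * p) t := by
  induction t using Tens.induction_on with
  | pure d₁ d₂ => simp only [split_tmul, Tens.smul_right, op_smul_eq_mul]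
  | add x y hx hy => simp only [smul_add, map_add, hx, hy]

variable {α} in
/-- The comultiplication `a ⊗ d ⊗ a' ↦ ∑ (a ⊗ d₁ ⊗ 1) ⊗_A (1 ⊗ d₂ ⊗ a')`. -/
def comul (𝔇 : Coring B D) : BaseExt α D →+
    Tens (RingHom.id A) (RingHom.id A) (BaseExt α D) (BaseExt α D) :=
  lift (fun a d a' => split α a a' (𝔇.comul.hom d))
    (fun _ _ _ _ => split_add_left _ _ _ _ _)
    (fun a d₁ d₂ a' => by
      rw [← map_add]; exact congrArg _ (𝔇.comul.hom.map_add d₁ d₂))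
    (fun _ _ _ _ => split_add_right _ _ _ _ _)
    (fun a b d a' => by rw [split_mul_left, 𝔇.comul.map_left]; rfl)
    (fun a b d a' => by rw [← split_mul_right, 𝔇.comul.map_right]; rfl)

variable {α} in
/-- The counit `a ⊗ d ⊗ a' ↦ a ε(d) a'`. -/
def counit (𝔇 : Coring B D) : BaseExt α D →+ A :=
  lift (fun a d a' => a * α (𝔇.counit.hom d) * a')
    (fun _ _ _ _ => by rw [add_mul, add_mul])
    (fun a d₁ d₂ a' => by
      have := 𝔇.counit.hom.map_add d₁ d₂
      rw [this, map_add, mul_add, add_mul])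
    (fun _ _ _ _ => mul_add _ _ _)
    (fun a b d a' => by
      rw [𝔇.counit.map_left, smul_eq_mul, map_mul, RingHom.id_apply]; simp only [mul_assoc])
    (fun a b d a' => by
      rw [𝔇.counit.map_right, op_smul_eq_mul, map_mul, RingHom.id_apply]; simp only [mul_assoc])

end BaseExt

/-- The base ring extension `A_α[𝔇]` of the `B`-coring `𝔇` along `α : B →+* A`: the `A`-coring
on `A ⊗_B D ⊗_B A` with `Δ(a ⊗ d ⊗ a') = ∑ (a ⊗ d₁ ⊗ 1) ⊗_A (1 ⊗ d₂ ⊗ a')` and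
`ε(a ⊗ d ⊗ a') = a ε(d) a'`. -/
def Coring.baseExt (𝔇 : Coring B D) : Coring A (BaseExt α D) where
  comul :=
    { hom := BaseExt.comul 𝔇
      map_left := fun p t => by
        change BaseExt.comul 𝔇 _ = _ • BaseExt.comul 𝔇 _
        induction t using BaseExt.induction_on with
        | pure a d a' => exact (BaseExt.smul_split α p a a' _).symm
        | add x y hx hy => simp only [smul_add, map_add, hx, hy]
      map_right := fun p t => by
        change BaseExt.comul 𝔇 _ = op (_ : A) • BaseExt.comul 𝔇 _
        induction t using BaseExt.induction_on with
        | pure a d a' => exact (BaseExt.op_smul_split α p a a' _).symm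
        | add x y hx hy => simp only [smul_add, map_add, hx, hy] }
  counit :=
    { hom := BaseExt.counit 𝔇
      map_left := fun p t => by
        change BaseExt.counit 𝔇 _ = _ • BaseExt.counit 𝔇 _
        induction t using BaseExt.induction_on with
        | pure a d a' =>
          change p * a * _ * _ = p * (a * _ * _)
          simp only [mul_assoc]
        | add x y hx hy => simp only [smul_add, map_add, hx, hy]
      map_right := fun p t => by
        change BaseExt.counit 𝔇 _ = op (_ : A) • BaseExt.counit 𝔇 _
        induction t using BaseExt.induction_on with
        | pure a d a' =>
          change a * _ * (a' * p) = a * _ * a' * p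
          simp only [mul_assoc]
        | add x y hx hy => simp only [smul_add, map_add, hx, hy] }
  coassoc t := by
    induction t using BaseExt.induction_on with
    | pure a d a' =>
      let G : Tens (RingHom.id B) (RingHom.id B) D (Tens (RingHom.id B) (RingHom.id B) D D) →+
          Tens (RingHom.id A) (RingHom.id A) (BaseExt α D)
            (Tens (RingHom.id A) (RingHom.id A) (BaseExt α D) (BaseExt α D)) :=
        Tens.lift (fun d s => Tens.tmul _ _ (BaseExt.mk α a d 1) (BaseExt.split α 1 a' s))
          (fun x y z => by rw [BaseExt.mk, Tens.add_tmul, Tens.tmul_add, Tens.add_tmul])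
          (fun x y z => by rw [map_add, Tens.tmul_add])
          (fun b x y => by
            have h1 : BaseExt.mk α a (op (RingHom.id B b) • x) 1
                = op (RingHom.id A (α b)) • BaseExt.mk α a x 1 := by
              rw [RingHom.id_apply, BaseExt.mk_bal_right]
              simp
            have h2 : BaseExt.split α 1 a' (RingHom.id B b • y)
                = RingHom.id A (α b) • BaseExt.split α 1 a' y := by
              rw [RingHom.id_apply, ← BaseExt.split_mul_left, RingHom.id_apply,
                BaseExt.smul_split, one_mul, mul_one]
            rw [h1, h2, Tens.smul_tmul])
      refine Eq.trans ?_ ((congrArg G (𝔇.coassoc d)).trans ?_)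
      · change Tens.assoc _ _ _ _ _ _ _ (Tens.rTensor _ (BaseExt.comul 𝔇) _
          (BaseExt.split α a a' (𝔇.comul.hom d))) = _
        generalize 𝔇.comul.hom d = s
        induction s using Tens.induction_on with
        | pure d₁ d₂ =>
          change Tens.assoc _ _ _ _ _ _ _ (Tens.tmul _ _
            (BaseExt.split α a 1 (𝔇.comul.hom d₁)) (BaseExt.mk α 1 d₂ a')) =
            G (Tens.assoc _ _ _ _ _ _ _ (Tens.tmul _ _ (𝔇.comul.hom d₁) d₂))
          generalize 𝔇.comul.hom d₁ = s
          induction s using Tens.induction_on with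
          | pure x y => rfl
          | add x y hx hy => simp only [Tens.add_tmul, map_add, hx, hy]
        | add x y hx hy => simp only [map_add, hx, hy]
      · change _ = Tens.lTensor _ (BaseExt.comul 𝔇) _
          (BaseExt.split α a a' (𝔇.comul.hom d))
        generalize 𝔇.comul.hom d = s
        induction s using Tens.induction_on with
        | pure d₁ d₂ => rfl
        | add x y hx hy => simp only [map_add, hx, hy]
    | add x y hx hy =>
      change Tens.assoc _ _ _ _ _ _ _ (Tens.rTensor _ (BaseExt.comul 𝔇) _
          (BaseExt.comul 𝔇 x)) = Tens.lTensor _ (BaseExt.comul 𝔇) _ (BaseExt.comul 𝔇 x) at hx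
      change Tens.assoc _ _ _ _ _ _ _ (Tens.rTensor _ (BaseExt.comul 𝔇) _
          (BaseExt.comul 𝔇 y)) = Tens.lTensor _ (BaseExt.comul 𝔇) _ (BaseExt.comul 𝔇 y) at hy
      change Tens.assoc _ _ _ _ _ _ _ (Tens.rTensor _ (BaseExt.comul 𝔇) _
          (BaseExt.comul 𝔇 (x + y))) =
        Tens.lTensor _ (BaseExt.comul 𝔇) _ (BaseExt.comul 𝔇 (x + y))
      simp only [map_add, hx, hy]
  counit_left t := by
    change Tens.unitLeft _ _ (Tens.rTensor _ (BaseExt.counit 𝔇) _ (BaseExt.comul 𝔇 t)) = t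
    induction t using BaseExt.induction_on with
    | pure a d a' =>
      refine Eq.trans ?_ (congrArg (fun x => BaseExt.mk α a x a') (𝔇.counit_left d))
      change Tens.unitLeft _ _ (Tens.rTensor _ (BaseExt.counit 𝔇) _
        (BaseExt.split α a a' (𝔇.comul.hom d))) = _
      generalize 𝔇.comul.hom d = s
      induction s using Tens.induction_on with
      | pure d₁ d₂ =>
        change BaseExt.mk α ((a * α (𝔇.counit.hom d₁) * 1) * 1) d₂ a' =
          BaseExt.mk α a (𝔇.counit.hom d₁ • d₂) a'
        rw [mul_one, mul_one, BaseExt.mk_bal_left]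
      | add x y hx hy => simp only [map_add, hx, hy, BaseExt.mk, Tens.add_tmul, Tens.tmul_add]
    | add x y hx hy => simp only [map_add, hx, hy]
  counit_right t := by
    change Tens.mulRight _ _ (Tens.lTensor _ (BaseExt.counit 𝔇) _ (BaseExt.comul 𝔇 t)) = t
    induction t using BaseExt.induction_on with
    | pure a d a' =>
      refine Eq.trans ?_ (congrArg (fun x => BaseExt.mk α a x a') (𝔇.counit_right d))
      change Tens.mulRight _ _ (Tens.lTensor _ (BaseExt.counit 𝔇) _
        (BaseExt.split α a a' (𝔇.comul.hom d))) = _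
      generalize 𝔇.comul.hom d = s
      induction s using Tens.induction_on with
      | pure d₁ d₂ =>
        change BaseExt.mk α a d₁ (1 * (1 * α (𝔇.counit.hom d₂) * a')) =
          BaseExt.mk α a (op (𝔇.counit.hom d₂) • d₁) a'
        rw [one_mul, one_mul, BaseExt.mk_bal_right]
      | add x y hx hy => simp only [map_add, hx, hy, BaseExt.mk, Tens.add_tmul, Tens.tmul_add]
    | add x y hx hy => simp only [map_add, hx, hy]

end BaseExt

section CoringHom

variable {A B : Type*} [Ring A] [Ring B] {α : B →+* A}
  {D : Type*} [AddCommGroup D] [Module B D] [Module Bᵐᵒᵖ D] [SMulCommClass B Bᵐᵒᵖ D]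
  {C : Type*} [AddCommGroup C] [Module A C] [Module Aᵐᵒᵖ C] [SMulCommClass A Aᵐᵒᵖ C]

/-- An `A`-bimodule map `φ` between `A`-corings is a morphism of `A`-corings:
`Δ ∘ φ = (φ ⊗_A φ) ∘ Δ` and `ε ∘ φ = ε`. -/
structure IsCoringHom {E : Type*} [AddCommGroup E] [Module A E] [Module Aᵐᵒᵖ E]
    [SMulCommClass A Aᵐᵒᵖ E] (𝔈 : Coring A E) (ℭ : Coring A C)
    (φ : BimodHom (RingHom.id A) E C) : Prop where
  comul : ∀ x, ℭ.comul.hom (φ.hom x) =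
    Tens.map (g := RingHom.id A) (g' := RingHom.id A) φ.hom φ.hom
      φ.map_right φ.map_left (𝔈.comul.hom x)
  counit : ∀ x, ℭ.counit.hom (φ.hom x) = 𝔈.counit.hom x

/-- The `A`-bimodule map `A ⊗_B D ⊗_B A → C`, `a ⊗ d ⊗ a' ↦ a γ(d) a'`, induced by a `B`-bimodule
map `γ : D → C`. -/
def BimodHom.induced (γ : BimodHom α D C) : BimodHom (RingHom.id A) (BaseExt α D) C :=
  let F : BaseExt α D →+ C := BaseExt.lift (fun a d a' => a • op a' • γ.hom d)
    (fun _ _ _ _ => add_smul _ _ _)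
    (fun a d₁ d₂ a' => by rw [map_add, smul_add, smul_add])
    (fun a d a₁ a₂ => by rw [MulOpposite.op_add, add_smul, smul_add])
    (fun a b d a' => by rw [γ.map_left, mul_smul, ← smul_comm (α b) (op a')])
    (fun a b d a' => by rw [γ.map_right, op_mul, mul_smul])
  { hom := F
    map_left := fun p t => by
      change F _ = p • F _
      induction t using BaseExt.induction_on with
      | pure a d a' => exact mul_smul _ _ _
      | add x y hx hy => simp only [smul_add, map_add, hx, hy]
    map_right := fun p t => by
      change F _ = op p • F _
      induction t using BaseExt.induction_on with
      | pure a d a' =>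
        change a • op (a' * p) • γ.hom d = op p • a • op a' • γ.hom d
        rw [op_mul, mul_smul, ← smul_comm a (op p)]
      | add x y hx hy => simp only [smul_add, map_add, hx, hy] }

/-- A morphism of corings `(γ, α) : (𝔇 : B) → (ℭ : A)`, for a given ring homomorphism `α`: a
`B`-bimodule map `γ : D → C` such that the induced map `A_α[𝔇] → ℭ` is a morphism of
`A`-corings. -/
structure CoringHom (𝔇 : Coring B D) (ℭ : Coring A C) (α : B →+* A) where
  γ : BimodHom α D C
  isCoringHom : IsCoringHom (𝔇.baseExt α) ℭ γ.induced

end CoringHom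

/-! ### Right comodules -/

section Comod

variable {A : Type*} [Ring A] {C : Type*} [AddCommGroup C] [Module A C] [Module Aᵐᵒᵖ C]
  [SMulCommClass A Aᵐᵒᵖ C]

/-- A right comodule over the `A`-coring `ℭ`. -/
structure Comod (ℭ : Coring A C) where
  carrier : Type w
  [addCommGroup : AddCommGroup carrier]
  [module : Module Aᵐᵒᵖ carrier]
  coact : carrier →ₗ[Aᵐᵒᵖ] Tens (RingHom.id A) (RingHom.id A) carrier C
  coassoc : ∀ x, Tens.assoc _ _ _ _ carrier C C
      (Tens.rTensorLin (RingHom.id A) (RingHom.id A) C coact (coact x)) =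
    Tens.lTensor carrier ℭ.comul.hom ℭ.comul.map_left (coact x)
  counit : ∀ x, Tens.mulRight _ carrier
    (Tens.lTensor carrier ℭ.counit.hom ℭ.counit.map_left (coact x)) = x

attribute [instance] Comod.addCommGroup Comod.module

/-- A colinear map between right `ℭ`-comodules. -/
@[ext]
structure Comod.Hom {ℭ : Coring A C} (X Y : Comod.{w} ℭ) where
  toLin : X.carrier →ₗ[Aᵐᵒᵖ] Y.carrier
  comm : ∀ x, Tens.rTensorLin (RingHom.id A) (RingHom.id A) C toLin (X.coact x) = Y.coact (toLin x)

/-- The category `M^ℭ` of right `ℭ`-comodules and colinear maps. -/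
instance (ℭ : Coring A C) : Category (Comod.{w} ℭ) where
  Hom X Y := Comod.Hom X Y
  id X := ⟨LinearMap.id, fun x => by
    change _ = X.coact x
    generalize X.coact x = s
    induction s using Tens.induction_on with
    | pure m n => rfl
    | add x y hx hy => simp only [map_add, hx, hy]⟩
  comp {X Y Z} φ ψ := ⟨ψ.toLin ∘ₗ φ.toLin, fun x => by
    change _ = Z.coact (ψ.toLin (φ.toLin x))
    rw [← ψ.comm, ← φ.comm]
    generalize X.coact x = s
    induction s using Tens.induction_on with
    | pure m n => rfl
    | add x y hx hy => simp only [map_add, hx, hy]⟩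

end Comod

/-! ### Descent data -/

section Desc

variable {A B : Type*} [Ring A] [Ring B] {α : B →+* A}
  {D : Type*} [AddCommGroup D] [Module B D] [Module Bᵐᵒᵖ D] [SMulCommClass B Bᵐᵒᵖ D]
  {C : Type*} [AddCommGroup C] [Module A C] [Module Aᵐᵒᵖ C] [SMulCommClass A Aᵐᵒᵖ C]

/-- `ε ⊗_B A : D ⊗_B A → B ⊗_B A ≃ A`. -/
def counitExt (α : B →+* A) (𝔇 : Coring B D) : Tens (RingHom.id B) α D A →+ A :=
  (Tens.unitLeft α A).comp (Tens.rTensor A 𝔇.counit.hom 𝔇.counit.map_right)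

theorem counitExt_smul (𝔇 : Coring B D) (b : B) (t : Tens (RingHom.id B) α D A) :
    counitExt α 𝔇 (RingHom.id B b • t) = α b • counitExt α 𝔇 t := by
  induction t using Tens.induction_on with
  | pure d a =>
    change α (𝔇.counit.hom (b • d)) * a = α b * (α (𝔇.counit.hom d) * a)
    rw [𝔇.counit.map_left, smul_eq_mul, map_mul, mul_assoc]; rfl
  | add x y hx hy => simp only [smul_add, map_add, hx, hy]

/-- The unit map `ν : N → A ⊗_B N`, `n ↦ 1 ⊗ n`, for a left `B`-module `N`. -/
def unitMap (α : B →+* A) (N : Type*) [AddCommGroup N] [Module B N] :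
    N →+ Tens α (RingHom.id B) A N :=
  AddMonoidHom.mk' (fun n => Tens.tmul _ _ 1 n) (fun _ _ => Tens.tmul_add _ _ _)

theorem unitMap_smul (α : B →+* A) (N : Type*) [AddCommGroup N] [Module B N] (b : B) (n : N) :
    unitMap α N (RingHom.id B b • n) = α b • unitMap α N n := by
  change Tens.tmul _ _ _ _ = α b • Tens.tmul _ _ _ _
  rw [Tens.smul_left, smul_eq_mul, mul_one, ← Tens.smul_tmul, op_smul_eq_mul, one_mul]

/-- The composite of `Δ ⊗_B A : D ⊗_B A → D ⊗_B D ⊗_B A` and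
`D ⊗_B ν ⊗_B A : D ⊗_B D ⊗_B A → D ⊗_B (A ⊗_B D ⊗_B A)`. -/
def comulExt (α : B →+* A) (𝔇 : Coring B D) : Tens (RingHom.id B) α D A →+
    Tens (RingHom.id B) α D (BaseExt α D) :=
  (Tens.lTensor (g := RingHom.id B) D (unitMap α (Tens (RingHom.id B) α D A))
    (unitMap_smul α _)).comp
  ((Tens.assoc _ _ _ _ D D A).comp
    (Tens.rTensor A 𝔇.comul.hom 𝔇.comul.map_right))

/-- The value `d₁ ⊗ d₂ ↦ d₁ ⊗ (1 ⊗ d₂ ⊗ a)`, through which `comulExt` is computed. -/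
def comulExtAux (α : B →+* A) (a : A) : Tens (RingHom.id B) (RingHom.id B) D D →+
    Tens (RingHom.id B) α D (BaseExt α D) :=
  Tens.lift (fun d₁ d₂ => Tens.tmul _ _ d₁ (BaseExt.mk α 1 d₂ a))
    (fun _ _ _ => Tens.add_tmul _ _ _)
    (fun x y z => by rw [BaseExt.mk, Tens.add_tmul, Tens.tmul_add, Tens.tmul_add])
    (fun b x y => by
      have h2 : BaseExt.mk α 1 (RingHom.id B b • y) a = α b • BaseExt.mk α 1 y a := by
        rw [RingHom.id_apply, ← BaseExt.mk_bal_left]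
        simp
      rw [h2, Tens.smul_tmul])

theorem comulExt_tmul (𝔇 : Coring B D) (d : D) (a : A) :
    comulExt α 𝔇 (Tens.tmul _ _ d a) = comulExtAux α a (𝔇.comul.hom d) := by
  change Tens.lTensor (g := RingHom.id B) D (unitMap α (Tens (RingHom.id B) α D A))
    (unitMap_smul α _) (Tens.assoc _ _ _ _ D D A (Tens.tmul _ _ (𝔇.comul.hom d) a)) = _
  generalize 𝔇.comul.hom d = s
  induction s using Tens.induction_on with
  | pure x y => rfl
  | add x y hx hy => simp only [Tens.add_tmul, map_add, hx, hy]

theorem comulExt_smul (𝔇 : Coring B D) (b : B) (t : Tens (RingHom.id B) α D A) :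
    comulExt α 𝔇 (RingHom.id B b • t) = RingHom.id B b • comulExt α 𝔇 t := by
  induction t using Tens.induction_on with
  | pure d a =>
    rw [Tens.smul_left, comulExt_tmul, comulExt_tmul, 𝔇.comul.map_left]
    change comulExtAux α a (b • 𝔇.comul.hom d) = b • comulExtAux α a (𝔇.comul.hom d)
    generalize 𝔇.comul.hom d = s
    induction s using Tens.induction_on with
    | pure x y => rfl
    | add x y hx hy => simp only [smul_add, map_add, hx, hy]
  | add x y hx hy => simp only [smul_add, map_add, hx, hy]

/-- The identification `(X ⊗_B D ⊗_B A) ⊗_B (D ⊗_B A) ≃ X ⊗_B (D ⊗_B (A ⊗_B D ⊗_B A))`. -/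
def regroup (α : B →+* A) (D : Type*) [AddCommGroup D] [Module B D] [Module Bᵐᵒᵖ D]
    [SMulCommClass B Bᵐᵒᵖ D] (X : Type*) [AddCommGroup X] [Module Aᵐᵒᵖ X] :
    Tens α (RingHom.id B) (Tens α (RingHom.id B) X (Tens (RingHom.id B) α D A))
      (Tens (RingHom.id B) α D A) →+
    Tens α (RingHom.id B) X (Tens (RingHom.id B) α D (BaseExt α D)) :=
  (Tens.lTensor X (Tens.assoc _ _ _ _ D A (Tens (RingHom.id B) α D A)) (fun b t => by
    induction t using Tens.induction_on with
    | pure u w =>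
      induction u using Tens.induction_on with
      | pure d a => rfl
      | add x y hx hy => simp only [Tens.add_tmul, smul_add, map_add, hx, hy]
    | add x y hx hy => simp only [smul_add, map_add, hx, hy])).comp
  (Tens.assoc _ _ _ _ X (Tens (RingHom.id B) α D A) (Tens (RingHom.id B) α D A))

/-- A (right) descent datum associated to a coring morphism `(γ, α) : (𝔇 : B) → (ℭ : A)`: a right
`A`-module `X` with a right `A`-linear map `ρ : X → X ⊗_B D ⊗_B A` such that the composite
`X → X ⊗_B D ⊗_B A → X ⊗_B A → X` is the identity and
`(ρ ⊗_B D ⊗_B A) ∘ ρ = (X ⊗_B D ⊗_B ν ⊗_B A) ∘ (X ⊗_B Δ ⊗_B A) ∘ ρ`. -/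
structure DescentDatum {𝔇 : Coring B D} {ℭ : Coring A C} (γ : CoringHom 𝔇 ℭ α) where
  carrier : Type w
  [addCommGroup : AddCommGroup carrier]
  [module : Module Aᵐᵒᵖ carrier]
  ρ : carrier →ₗ[Aᵐᵒᵖ] Tens α (RingHom.id B) carrier (Tens (RingHom.id B) α D A)
  counit : ∀ x, Tens.mulRight α carrier
    (Tens.lTensor carrier (counitExt α 𝔇) (counitExt_smul 𝔇) (ρ x)) = x
  coassoc : ∀ x, regroup α D carrier
      (Tens.rTensorLin α (RingHom.id B) (Tens (RingHom.id B) α D A) ρ (ρ x)) =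
    Tens.lTensor carrier (comulExt α 𝔇) (comulExt_smul 𝔇) (ρ x)

attribute [instance] DescentDatum.addCommGroup DescentDatum.module

variable {𝔇 : Coring B D} {ℭ : Coring A C}

/-- A morphism of descent data. -/
@[ext]
structure DescentDatum.Hom {γ : CoringHom 𝔇 ℭ α} (X Y : DescentDatum.{w} γ) where
  toLin : X.carrier →ₗ[Aᵐᵒᵖ] Y.carrier
  comm : ∀ x, Tens.rTensorLin α (RingHom.id B) (Tens (RingHom.id B) α D A) toLin
    (X.ρ x) = Y.ρ (toLin x)

/-- The category `Desc_(γ,α)` of right descent data associated to `(γ, α)`. -/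
instance (γ : CoringHom 𝔇 ℭ α) : Category (DescentDatum.{w} γ) where
  Hom X Y := DescentDatum.Hom X Y
  id X := ⟨LinearMap.id, fun x => by
    change _ = X.ρ x
    generalize X.ρ x = s
    induction s using Tens.induction_on with
    | pure m n => rfl
    | add x y hx hy => simp only [map_add, hx, hy]⟩
  comp {X Y Z} φ ψ := ⟨ψ.toLin ∘ₗ φ.toLin, fun x => by
    change _ = Z.ρ (ψ.toLin (φ.toLin x))
    rw [← ψ.comm, ← φ.comm]
    generalize X.ρ x = s
    induction s using Tens.induction_on with
    | pure m n => rfl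
    | add x y hx hy => simp only [map_add, hx, hy]⟩

end Desc

/-! ### From comodules over the base ring extension to descent data -/

section ComodToDesc

variable {A B : Type*} [Ring A] [Ring B] {α : B →+* A}
  {D : Type*} [AddCommGroup D] [Module B D] [Module Bᵐᵒᵖ D] [SMulCommClass B Bᵐᵒᵖ D]
  {C : Type*} [AddCommGroup C] [Module A C] [Module Aᵐᵒᵖ C] [SMulCommClass A Aᵐᵒᵖ C]

/-- The isomorphism `X ⊗_A (A ⊗_B W) ≃ X ⊗_B W`, `x ⊗ (a ⊗ w) ↦ (x·a) ⊗ w`. -/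
def collapse (α : B →+* A) (X W : Type*) [AddCommGroup X] [Module Aᵐᵒᵖ X] [AddCommGroup W]
    [Module B W] : Tens (RingHom.id A) (RingHom.id A) X (Tens α (RingHom.id B) A W) →+
      Tens α (RingHom.id B) X W :=
  Tens.lift
    (fun x t => Tens.lift (f := α) (g := RingHom.id B)
      (fun a w => Tens.tmul α (RingHom.id B) (op a • x) w)
      (fun a a' w => by rw [MulOpposite.op_add, add_smul, Tens.add_tmul])
      (fun a w w' => Tens.tmul_add _ _ _)
      (fun b a w => by rw [op_smul_eq_mul, op_mul, mul_smul, Tens.smul_tmul]) t)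
    (fun x y t => by
      induction t using Tens.induction_on with
      | pure a w => simp only [Tens.lift_tmul, smul_add, Tens.add_tmul]
      | add s t hs ht => simp only [map_add, hs, ht]; abel)
    (fun x t t' => map_add _ _ _)
    (fun b x t => by
      induction t using Tens.induction_on with
      | pure a w =>
        simp only [Tens.smul_left, Tens.lift_tmul, smul_smul, ← op_mul, smul_eq_mul,
          RingHom.id_apply]
      | add s t hs ht => simp only [smul_add, map_add, hs, ht])

@[simp] theorem collapse_tmul {X W : Type*} [AddCommGroup X] [Module Aᵐᵒᵖ X] [AddCommGroup W]
    [Module B W] (x : X) (a : A) (w : W) :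
    collapse α X W (Tens.tmul _ _ x (Tens.tmul _ _ a w)) = Tens.tmul _ _ (op a • x) w := rfl

theorem collapse_smul {X W : Type*} [AddCommGroup X] [Module Aᵐᵒᵖ X] [AddCommGroup W]
    [Module B W] [Module Aᵐᵒᵖ W] [SMulCommClass B Aᵐᵒᵖ W] (a : A)
    (t : Tens (RingHom.id A) (RingHom.id A) X (Tens α (RingHom.id B) A W)) :
    collapse α X W (op a • t) = op a • collapse α X W t := by
  induction t using Tens.induction_on with
  | pure x s =>
    induction s using Tens.induction_on with
    | pure c w => rfl
    | add x y hx hy => simp only [Tens.tmul_add, smul_add, map_add, hx, hy]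
  | add x y hx hy => simp only [smul_add, map_add, hx, hy]

/-- The right `A`-linear map `X → X ⊗_A (A ⊗_B D ⊗_B A) ≃ X ⊗_B D ⊗_B A` given by `φ`. -/
def collapseLin {X : Type*} [AddCommGroup X] [Module Aᵐᵒᵖ X]
    (φ : X →ₗ[Aᵐᵒᵖ] Tens (RingHom.id A) (RingHom.id A) X (BaseExt α D)) :
    X →ₗ[Aᵐᵒᵖ] Tens α (RingHom.id B) X (Tens (RingHom.id B) α D A) where
  toFun x := collapse α X (Tens (RingHom.id B) α D A) (φ x)
  map_add' x y := by rw [map_add, map_add]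
  map_smul' a x := by
    rw [map_smul, ← op_unop a, collapse_smul]; rfl

theorem collapse_rTensorLin {X Y : Type*} [AddCommGroup X] [Module Aᵐᵒᵖ X] [AddCommGroup Y]
    [Module Aᵐᵒᵖ Y] {W : Type*} [AddCommGroup W] [Module B W] (φ : X →ₗ[Aᵐᵒᵖ] Y)
    (s : Tens (RingHom.id A) (RingHom.id A) X (Tens α (RingHom.id B) A W)) :
    Tens.rTensorLin α (RingHom.id B) W φ (collapse α X W s) =
      collapse α Y W (Tens.rTensorLin (RingHom.id A) (RingHom.id A) _ φ s) := by
  induction s using Tens.induction_on with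
  | pure y e =>
    induction e using Tens.induction_on with
    | pure a t =>
      simp only [collapse_tmul, Tens.rTensorLin_tmul, map_smul]
    | add x y hx hy => simp only [Tens.tmul_add, map_add, hx, hy]
  | add x y hx hy => simp only [map_add, hx, hy]

/-- An auxiliary map `X ⊗_A (E ⊗_A E) → X ⊗_B (D ⊗_B E)` with `E = A ⊗_B D ⊗_B A`. -/
def collapse₂ (α : B →+* A) (D : Type*) [AddCommGroup D] [Module B D] [Module Bᵐᵒᵖ D]
    [SMulCommClass B Bᵐᵒᵖ D] (X : Type*) [AddCommGroup X] [Module Aᵐᵒᵖ X] :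
    Tens (RingHom.id A) (RingHom.id A) X
      (Tens (RingHom.id A) (RingHom.id A) (BaseExt α D) (BaseExt α D)) →+
    Tens α (RingHom.id B) X (Tens (RingHom.id B) α D (BaseExt α D)) :=
  let μ : Tens (RingHom.id A) (RingHom.id A) (Tens (RingHom.id B) α D A) (BaseExt α D) →+
      Tens (RingHom.id B) α D (BaseExt α D) :=
    (Tens.lTensor D (Tens.unitLeft (RingHom.id A) (BaseExt α D))
      (g := α) (g' := α) (fun b t => by
        induction t using Tens.induction_on with
        | pure a e => exact mul_smul (α b) a e
        | add x y hx hy => simp only [smul_add, map_add, hx, hy])).comp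
    (Tens.assoc _ _ _ _ D A (BaseExt α D))
  (Tens.lTensor X μ (fun b t => by
    induction t using Tens.induction_on with
    | pure u w =>
      induction u using Tens.induction_on with
      | pure d a => rfl
      | add x y hx hy => simp only [Tens.add_tmul, smul_add, map_add, hx, hy]
    | add x y hx hy => simp only [smul_add, map_add, hx, hy])).comp
  ((collapse α X _).comp
    (Tens.lTensor X (Tens.assoc _ _ _ _ A (Tens (RingHom.id B) α D A) (BaseExt α D))
      (fun b t => by
        induction t using Tens.induction_on with
        | pure u w =>
          induction u using Tens.induction_on with
          | pure d a => rfl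
          | add x y hx hy => simp only [Tens.add_tmul, smul_add, map_add, hx, hy]
        | add x y hx hy => simp only [smul_add, map_add, hx, hy])))

variable {𝔇 : Coring B D} {ℭ : Coring A C}

theorem collapse₂_tmul {X : Type*} [AddCommGroup X] [Module Aᵐᵒᵖ X] (x : X) (c : A) (d : D)
    (a : A) (e : BaseExt α D) :
    collapse₂ α D X (Tens.tmul _ _ x (Tens.tmul _ _ (BaseExt.mk α c d a) e)) =
      Tens.tmul _ _ (op c • x) (Tens.tmul _ _ d (a • e)) := rfl

theorem regroup_collapse {X : Type*} [AddCommGroup X] [Module Aᵐᵒᵖ X]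
    (φ : X →ₗ[Aᵐᵒᵖ] Tens (RingHom.id A) (RingHom.id A) X (BaseExt α D))
    (s : Tens (RingHom.id A) (RingHom.id A) X (BaseExt α D)) :
    regroup α D X (Tens.rTensorLin α (RingHom.id B) (Tens (RingHom.id B) α D A)
      (collapseLin φ) (collapse α X (Tens (RingHom.id B) α D A) s)) =
    collapse₂ α D X (Tens.assoc _ _ _ _ X (BaseExt α D) (BaseExt α D)
      (Tens.rTensorLin (RingHom.id A) (RingHom.id A) (BaseExt α D) φ s)) := by
  induction s using Tens.induction_on with
  | pure y e =>
    induction e using Tens.induction_on with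
    | pure a t =>
      rw [collapse_tmul, Tens.rTensorLin_tmul, Tens.rTensorLin_tmul, map_smul]
      change regroup α D X (Tens.tmul _ _ (op a • collapse α X _ (φ y)) t) = _
      generalize φ y = s
      induction s using Tens.induction_on with
      | pure z e =>
        induction e using BaseExt.induction_on with
        | pure c d c' => rfl
        | add x y hx hy =>
          simp only [Tens.tmul_add, Tens.add_tmul, smul_add, map_add, hx, hy]
      | add x y hx hy => simp only [Tens.add_tmul, smul_add, map_add, hx, hy]
    | add x y hx hy => simp only [Tens.tmul_add, map_add, hx, hy]
  | add x y hx hy => simp only [map_add, hx, hy]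

theorem collapse₂_comul (𝔇 : Coring B D) {X : Type*} [AddCommGroup X] [Module Aᵐᵒᵖ X]
    (h : ∀ (a : A) (e : BaseExt α D), BaseExt.comul 𝔇 (RingHom.id A a • e) =
      RingHom.id A a • BaseExt.comul 𝔇 e)
    (s : Tens (RingHom.id A) (RingHom.id A) X (BaseExt α D)) :
    collapse₂ α D X (Tens.lTensor X (BaseExt.comul 𝔇) h s) =
      Tens.lTensor X (comulExt α 𝔇) (comulExt_smul 𝔇) (collapse α X _ s) := by
  induction s using Tens.induction_on with
  | pure y e =>
    induction e using BaseExt.induction_on with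
    | pure a d a' =>
      rw [collapse_tmul, Tens.map_tmul, Tens.map_tmul, comulExt_tmul, AddMonoidHom.id_apply,
        AddMonoidHom.id_apply]
      change collapse₂ α D X (Tens.tmul _ _ y (BaseExt.split α a a' (𝔇.comul.hom d))) = _
      generalize 𝔇.comul.hom d = s
      induction s using Tens.induction_on with
      | pure d₁ d₂ => rw [BaseExt.split_tmul, collapse₂_tmul, one_smul]; rfl
      | add x y hx hy => simp only [Tens.tmul_add, map_add, hx, hy]
    | add x y hx hy => simp only [Tens.tmul_add, map_add, hx, hy]
  | add x y hx hy => simp only [map_add, hx, hy]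

/-- The descent datum `X → X ⊗_A (A ⊗_B D ⊗_B A) ≃ X ⊗_B D ⊗_B A` of an `A_α[𝔇]`-comodule `X`. -/
def comodToDescObj (γ : CoringHom 𝔇 ℭ α) (X : Comod.{w} (𝔇.baseExt α)) : DescentDatum.{w} γ where
  carrier := X.carrier
  ρ := collapseLin X.coact
  counit x := by
    refine Eq.trans ?_ (X.counit x)
    change Tens.mulRight _ _ (Tens.lTensor _ _ _ (collapse α _ _ (X.coact x))) =
      Tens.mulRight _ _ (Tens.lTensor _ (BaseExt.counit 𝔇) _ (X.coact x))
    generalize X.coact x = s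
    induction s using Tens.induction_on with
    | pure y e =>
      induction e using BaseExt.induction_on with
      | pure a d a' =>
        change op (α (𝔇.counit.hom d) * a') • op a • y = op (a * α (𝔇.counit.hom d) * a') • y
        rw [smul_smul, ← op_mul, mul_assoc]
      | add x y hx hy => simp only [Tens.tmul_add, map_add, hx, hy]
    | add x y hx hy => simp only [map_add, hx, hy]
  coassoc x := by
    refine Eq.trans ?_ ((congrArg (collapse₂ α D X.carrier) (X.coassoc x)).trans ?_)
    · exact regroup_collapse X.coact (X.coact x)
    · exact collapse₂_comul 𝔇 _ (X.coact x)

/-- The functor `M^{A_α[𝔇]} ⥤ Desc_(γ,α)`: it keeps the underlying right `A`-modules and linear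
maps, and turns the coaction into `X → X ⊗_A (A ⊗_B D ⊗_B A) ≃ X ⊗_B D ⊗_B A`. -/
def comodToDesc (γ : CoringHom 𝔇 ℭ α) : Comod.{w} (𝔇.baseExt α) ⥤ DescentDatum.{w} γ where
  obj X := comodToDescObj γ X
  map {X Y} φ := ⟨φ.toLin, fun x =>
    (collapse_rTensorLin φ.toLin (X.coact x)).trans
      (congrArg (collapse α Y.carrier _) (φ.comm x))⟩

end ComodToDesc

/-! ### The functor `- ⊗_B A` on comodules -/

section PushOut

variable {A B : Type*} [Ring A] [Ring B] (α : B →+* A)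
  {D : Type*} [AddCommGroup D] [Module B D] [Module Bᵐᵒᵖ D] [SMulCommClass B Bᵐᵒᵖ D]

/-- The map `m ⊗ d ↦ (m ⊗ 1) ⊗_A (1 ⊗ d ⊗ a)`. -/
def pushAux (M : Type*) [AddCommGroup M] [Module Bᵐᵒᵖ M] (a : A) :
    Tens (RingHom.id B) (RingHom.id B) M D →+
      Tens (RingHom.id A) (RingHom.id A) (Tens (RingHom.id B) α M A) (BaseExt α D) :=
  Tens.lift (fun m d => Tens.tmul _ _ (Tens.tmul _ _ m 1) (BaseExt.mk α 1 d a))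
    (fun x y z => by rw [Tens.add_tmul, Tens.add_tmul])
    (fun x y z => by rw [BaseExt.mk, Tens.add_tmul, Tens.tmul_add, Tens.tmul_add])
    (fun b x y => by
      have h1 : Tens.tmul (RingHom.id B) α (op (RingHom.id B b) • x) (1 : A) =
          op (RingHom.id A (α b)) • Tens.tmul (RingHom.id B) α x (1 : A) := by
        rw [Tens.smul_tmul]
        simp
      have h2 : BaseExt.mk α 1 (RingHom.id B b • y) a = RingHom.id A (α b) • BaseExt.mk α 1 y a := by
        rw [RingHom.id_apply, ← BaseExt.mk_bal_left]
        simp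
      rw [h1, h2, Tens.smul_tmul])

/-- The coaction `m ⊗ a ↦ ∑ (m₀ ⊗ 1) ⊗_A (1 ⊗ m₁ ⊗ a)` of `A_α[𝔇]` on `M ⊗_B A`. -/
def pushCoact {𝔇 : Coring B D} (M : Comod.{w} 𝔇) :
    Tens (RingHom.id B) α M.carrier A →ₗ[Aᵐᵒᵖ]
      Tens (RingHom.id A) (RingHom.id A) (Tens (RingHom.id B) α M.carrier A) (BaseExt α D) :=
  let F := Tens.lift (f := RingHom.id B) (g := α)
    (fun (m : M.carrier) (a : A) => pushAux α (D := D) M.carrier a (M.coact m))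
    (fun m m' a => by rw [map_add, map_add])
    (fun m a a' => by
      generalize M.coact m = s
      induction s using Tens.induction_on with
      | pure x y => simp only [pushAux, Tens.lift_tmul, BaseExt.mk, Tens.tmul_add]
      | add x y hx hy => simp only [map_add, hx, hy]; abel)
    (fun b m a => by
      rw [map_smul]
      generalize M.coact m = s
      induction s using Tens.induction_on with
      | pure x y =>
        simp only [pushAux, Tens.smul_right, Tens.lift_tmul, RingHom.id_apply,
          BaseExt.mk_bal_right, smul_eq_mul]
      | add x y hx hy => simp only [smul_add, map_add, hx, hy])
  { F with
    map_smul' := fun c t => by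
      change F _ = c • F _
      induction t using Tens.induction_on with
      | pure m a =>
        change pushAux α M.carrier (c • a) (M.coact m) = c • pushAux α M.carrier a (M.coact m)
        generalize M.coact m = s
        induction s using Tens.induction_on with
        | pure x y => rfl
        | add x y hx hy => simp only [smul_add, map_add, hx, hy]
      | add x y hx hy => simp only [smul_add, map_add, hx, hy] }

theorem pushCoact_tmul {𝔇 : Coring B D} (M : Comod.{w} 𝔇) (m : M.carrier) (a : A) :
    pushCoact α M (Tens.tmul _ _ m a) = pushAux α M.carrier a (M.coact m) := rfl

/-- The map `m ⊗ (d ⊗ d') ↦ (m ⊗ 1) ⊗_A ((1 ⊗ d ⊗ 1) ⊗_A (1 ⊗ d' ⊗ a))`. -/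
def pushAux₂ (M : Type*) [AddCommGroup M] [Module Bᵐᵒᵖ M] (a : A) :
    Tens (RingHom.id B) (RingHom.id B) M (Tens (RingHom.id B) (RingHom.id B) D D) →+
      Tens (RingHom.id A) (RingHom.id A) (Tens (RingHom.id B) α M A)
        (Tens (RingHom.id A) (RingHom.id A) (BaseExt α D) (BaseExt α D)) :=
  Tens.lift (fun m s => Tens.tmul _ _ (Tens.tmul _ _ m 1) (BaseExt.split α 1 a s))
    (fun x y z => by rw [Tens.add_tmul, Tens.add_tmul])
    (fun x y z => by rw [map_add, Tens.tmul_add])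
    (fun b x y => by
      have h1 : Tens.tmul (RingHom.id B) α (op (RingHom.id B b) • x) (1 : A) =
          op (RingHom.id A (α b)) • Tens.tmul (RingHom.id B) α x (1 : A) := by
        rw [Tens.smul_tmul]
        simp
      have h2 : BaseExt.split α 1 a (RingHom.id B b • y)
          = RingHom.id A (α b) • BaseExt.split α 1 a y := by
        rw [RingHom.id_apply, ← BaseExt.split_mul_left, RingHom.id_apply,
          BaseExt.smul_split, one_mul, mul_one]
      rw [h1, h2, Tens.smul_tmul])

theorem pushCoact_coassoc_left {𝔇 : Coring B D} (M : Comod.{w} 𝔇) (a : A)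
    (s : Tens (RingHom.id B) (RingHom.id B) M.carrier D) :
    Tens.assoc _ _ _ _ (Tens (RingHom.id B) α M.carrier A) (BaseExt α D) (BaseExt α D)
      (Tens.rTensorLin (RingHom.id A) (RingHom.id A) (BaseExt α D) (pushCoact α M)
        (pushAux α M.carrier a s)) =
    pushAux₂ α M.carrier a (Tens.assoc _ _ _ _ M.carrier D D
      (Tens.rTensorLin (RingHom.id B) (RingHom.id B) D M.coact s)) := by
  induction s using Tens.induction_on with
  | pure m d =>
    change Tens.assoc _ _ _ _ (Tens (RingHom.id B) α M.carrier A) (BaseExt α D) (BaseExt α D)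
      (Tens.tmul _ _ (pushAux α M.carrier 1 (M.coact m)) (BaseExt.mk α 1 d a)) =
      pushAux₂ α M.carrier a (Tens.assoc _ _ _ _ M.carrier D D (Tens.tmul _ _ (M.coact m) d))
    generalize M.coact m = s
    induction s using Tens.induction_on with
    | pure x y => rfl
    | add x y hx hy => simp only [Tens.add_tmul, map_add, hx, hy]
  | add x y hx hy => simp only [map_add, hx, hy]

theorem pushCoact_coassoc_right {𝔇 : Coring B D} (M : Comod.{w} 𝔇) (a : A)
    (s : Tens (RingHom.id B) (RingHom.id B) M.carrier D) :
    Tens.lTensor (Tens (RingHom.id B) α M.carrier A) (𝔇.baseExt α).comul.hom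
      (𝔇.baseExt α).comul.map_left (pushAux α M.carrier a s) =
    pushAux₂ α M.carrier a
      (Tens.lTensor M.carrier 𝔇.comul.hom 𝔇.comul.map_left s) := by
  induction s using Tens.induction_on with
  | pure m d => rfl
  | add x y hx hy => simp only [map_add, hx, hy]

theorem pushCoact_counit {𝔇 : Coring B D} (M : Comod.{w} 𝔇) (a : A)
    (s : Tens (RingHom.id B) (RingHom.id B) M.carrier D) :
    Tens.mulRight _ (Tens (RingHom.id B) α M.carrier A)
      (Tens.lTensor (Tens (RingHom.id B) α M.carrier A) (𝔇.baseExt α).counit.hom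
        (𝔇.baseExt α).counit.map_left (pushAux α M.carrier a s)) =
    Tens.tmul (RingHom.id B) α (Tens.mulRight _ M.carrier
      (Tens.lTensor M.carrier 𝔇.counit.hom 𝔇.counit.map_left s)) a := by
  induction s using Tens.induction_on with
  | pure m d =>
    change Tens.tmul (RingHom.id B) α m ((1 : A) * (1 * α (𝔇.counit.hom d) * a)) =
      Tens.tmul (RingHom.id B) α (op (RingHom.id B (𝔇.counit.hom d)) • m) a
    rw [Tens.smul_tmul, one_mul, one_mul]; rfl
  | add x y hx hy => simp only [Tens.add_tmul, map_add, hx, hy]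

/-- The `A_α[𝔇]`-comodule `M ⊗_B A` of a `𝔇`-comodule `M`, with coaction
`m ⊗ a ↦ ∑ (m₀ ⊗ 1) ⊗_A (1 ⊗ m₁ ⊗ a)`. -/
def pushOutObj {𝔇 : Coring B D} (M : Comod.{w} 𝔇) : Comod (𝔇.baseExt α) where
  carrier := Tens (RingHom.id B) α M.carrier A
  coact := pushCoact α M
  coassoc t := by
    induction t using Tens.induction_on with
    | pure m a =>
      rw [pushCoact_tmul, pushCoact_coassoc_left, M.coassoc, pushCoact_coassoc_right]
    | add x y hx hy => simp only [map_add, hx, hy]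
  counit t := by
    induction t using Tens.induction_on with
    | pure m a => rw [pushCoact_tmul, pushCoact_counit, M.counit]
    | add x y hx hy => simp only [map_add, hx, hy]

/-- The right `A`-linear map `φ ⊗_B A : M ⊗_B A → N ⊗_B A`. -/
def pushMap {M N : Type*} [AddCommGroup M] [Module Bᵐᵒᵖ M] [AddCommGroup N] [Module Bᵐᵒᵖ N]
    (φ : M →ₗ[Bᵐᵒᵖ] N) : Tens (RingHom.id B) α M A →ₗ[Aᵐᵒᵖ] Tens (RingHom.id B) α N A :=
  let F := Tens.rTensorLin (RingHom.id B) α A φ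
  { F with
    map_smul' := fun c t => by
      change F _ = c • F _
      induction t using Tens.induction_on with
      | pure m a => rfl
      | add x y hx hy => simp only [smul_add, map_add, hx, hy] }

theorem pushMap_pushAux {M N : Type*} [AddCommGroup M] [Module Bᵐᵒᵖ M] [AddCommGroup N]
    [Module Bᵐᵒᵖ N] (φ : M →ₗ[Bᵐᵒᵖ] N) (a : A) (s : Tens (RingHom.id B) (RingHom.id B) M D) :
    Tens.rTensorLin (RingHom.id A) (RingHom.id A) (BaseExt α D) (pushMap α φ)
      (pushAux α M a s) =
    pushAux α N a (Tens.rTensorLin (RingHom.id B) (RingHom.id B) D φ s) := by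
  induction s using Tens.induction_on with
  | pure m d => rfl
  | add x y hx hy => simp only [map_add, hx, hy]

/-- The functor `- ⊗_B A : M^𝔇 ⥤ M^{A_α[𝔇]}`, `M ↦ M ⊗_B A`, `φ ↦ φ ⊗_B A`. -/
def pushOut (𝔇 : Coring B D) : Comod.{w} 𝔇 ⥤ Comod (𝔇.baseExt α) where
  obj M := pushOutObj α M
  map {M N} φ := ⟨pushMap α φ.toLin, fun t => by
    change Tens.rTensorLin (RingHom.id A) (RingHom.id A) (BaseExt α D) (pushMap α φ.toLin)
      (pushCoact α M t) = pushCoact α N (pushMap α φ.toLin t)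
    induction t using Tens.induction_on with
    | pure m a =>
      rw [pushCoact_tmul, pushMap_pushAux, φ.comm]; rfl
    | add x y hx hy => simp only [map_add, hx, hy]⟩
  map_id M := by
    refine Comod.Hom.ext (LinearMap.ext fun t => ?_)
    change pushMap α LinearMap.id t = t
    induction t using Tens.induction_on with
    | pure m a => rfl
    | add x y hx hy => simp only [map_add, hx, hy]
  map_comp {M N K} φ ψ := by
    refine Comod.Hom.ext (LinearMap.ext fun t => ?_)
    change pushMap α (ψ.toLin ∘ₗ φ.toLin) t = pushMap α ψ.toLin (pushMap α φ.toLin t)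
    induction t using Tens.induction_on with
    | pure m a => rfl
    | add x y hx hy => simp only [map_add, hx, hy]

end PushOut

/-! ### Flatness over noncommutative rings -/

section Flat

variable {B : Type u} {S : Type*} [Ring B] [Ring S]

/-- The left `S`-module `N`, regarded as a left `B`-module along `g : B →+* S`, is flat:
`- ⊗_B N` preserves injectivity of maps of right `B`-modules. -/
def IsLeftFlat (g : B →+* S) (N : Type*) [AddCommGroup N] [Module S N] : Prop :=
  ∀ (X Y : Type u) [AddCommGroup X] [Module Bᵐᵒᵖ X] [AddCommGroup Y] [Module Bᵐᵒᵖ Y]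
    (φ : X →ₗ[Bᵐᵒᵖ] Y), Function.Injective φ →
      Function.Injective (Tens.rTensorLin (RingHom.id B) g N φ)

/-- The left `S`-module `N`, regarded as a left `B`-module along `g : B →+* S`, is faithfully
flat: a sequence `X → Y → Z` of right `B`-modules is exact if and only if
`X ⊗_B N → Y ⊗_B N → Z ⊗_B N` is exact. -/
def IsLeftFaithfullyFlat (g : B →+* S) (N : Type*) [AddCommGroup N] [Module S N] : Prop :=
  ∀ (X Y Z : Type u) [AddCommGroup X] [Module Bᵐᵒᵖ X] [AddCommGroup Y] [Module Bᵐᵒᵖ Y]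
    [AddCommGroup Z] [Module Bᵐᵒᵖ Z] (φ : X →ₗ[Bᵐᵒᵖ] Y) (ψ : Y →ₗ[Bᵐᵒᵖ] Z),
      Function.Exact φ ψ ↔
        Function.Exact (Tens.rTensorLin (RingHom.id B) g N φ)
          (Tens.rTensorLin (RingHom.id B) g N ψ)

end Flat

end CoringDescent

open CoringDescent

/-!
Descent data and comodules over `A_α[𝔇] = A ⊗_B D ⊗_B A` differ only by the identification
`X ⊗_A (A ⊗_B W) ≃ X ⊗_B W`, the map `collapse`, which has the inverse `x ⊗ w ↦ x ⊗ (1 ⊗ w)`.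
Transporting coactions along it is a bijection on objects that keeps carriers and maps, so
`comodToDesc` is an isomorphism of categories with inverse `descToComod`.

For the second part it therefore suffices to treat the composite `pushOutDesc` of `- ⊗_B A` with
`comodToDesc`, and this is comonadic descent.  A descent datum `(X, ρ)` gives two right `B`-linear
maps `X ⊗_B D → (X ⊗_B D ⊗_B A) ⊗_B D`, namely `ρ ⊗_B D` and
`x ⊗ d ↦ ∑ (x ⊗ d₁ ⊗ 1) ⊗ d₂`.  Let `DescentDatum.defect` be their difference.  After tensoring
with `A` the sequence
`X → X ⊗_B D ⊗_B A → (X ⊗_B D ⊗_B A) ⊗_B D ⊗_B A` is split exact by the counit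
(`DescentDatum.rTensorLin_defect_eq_zero_iff`), for every descent datum.

* For `X = N ⊗_B A` the map `N → (N ⊗_B A) ⊗_B D`, `n ↦ ∑ (n₀ ⊗ 1) ⊗ n₁`, becomes `ρ` after
  tensoring with `A`.  Faithful flatness of `A` then makes it a kernel of the defect
  (`Comod.embed_injective`, `Comod.embed_exact`).  As the defect is natural in `X`, a morphism
  `M ⊗_B A → N ⊗_B A` restricts to these kernels, which yields fullness and faithfulness.
* For arbitrary `X`, flatness of `D` makes the kernel `M` of the defect a `𝔇`-comodule
  (`DescentDatum.exists_comod_ker_defect`).  Flatness of `A` identifies `M ⊗_B A` with the image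
  of `ρ`, that is, with `X`; so the functor is essentially surjective.

Identities between maps of iterated tensor products are checked on pure tensors.  Where the
comultiplication `Δ d` occurs, it is generalized to an arbitrary tensor first, so that the check is
again on pure tensors.
-/

/-! ### The inverse of `comodToDesc` -/

namespace CoringDescent

section InverseFunctor

variable {A B : Type*} [Ring A] [Ring B] {α : B →+* A}
  {D : Type*} [AddCommGroup D] [Module B D] [Module Bᵐᵒᵖ D] [SMulCommClass B Bᵐᵒᵖ D]
  {C : Type*} [AddCommGroup C] [Module A C] [Module Aᵐᵒᵖ C] [SMulCommClass A Aᵐᵒᵖ C]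

/-- The inverse `x ⊗ w ↦ x ⊗ (1 ⊗ w)` of `collapse`. -/
def expand (α : B →+* A) (X W : Type*) [AddCommGroup X] [Module Aᵐᵒᵖ X] [AddCommGroup W]
    [Module B W] : Tens α (RingHom.id B) X W →+
      Tens (RingHom.id A) (RingHom.id A) X (Tens α (RingHom.id B) A W) :=
  Tens.lift (fun x w => Tens.tmul _ _ x (Tens.tmul _ _ 1 w))
    (fun x y w => Tens.add_tmul _ _ _)
    (fun x w w' => by rw [Tens.tmul_add, Tens.tmul_add])
    (fun b x w => by
      have h := Tens.smul_tmul (f := RingHom.id A) (g := RingHom.id A) (α b) x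
        (Tens.tmul α (RingHom.id B) (1 : A) w)
      rw [RingHom.id_apply] at h
      rw [h, Tens.smul_left, smul_eq_mul, mul_one, ← Tens.smul_tmul, op_smul_eq_mul, one_mul])

theorem collapse_expand {X W : Type*} [AddCommGroup X] [Module Aᵐᵒᵖ X] [AddCommGroup W]
    [Module B W] (t : Tens α (RingHom.id B) X W) :
    collapse α X W (expand α X W t) = t := by
  induction t using Tens.induction_on with
  | pure x w =>
    change Tens.tmul _ _ (op (1 : A) • x) w = _
    rw [op_one, one_smul]
  | add x y hx hy => simp only [map_add, hx, hy]

theorem expand_collapse {X W : Type*} [AddCommGroup X] [Module Aᵐᵒᵖ X] [AddCommGroup W]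
    [Module B W] (t : Tens (RingHom.id A) (RingHom.id A) X (Tens α (RingHom.id B) A W)) :
    expand α X W (collapse α X W t) = t := by
  induction t using Tens.induction_on with
  | pure x s =>
    induction s using Tens.induction_on with
    | pure a w =>
      change Tens.tmul _ _ (op (RingHom.id A a) • x) (Tens.tmul _ _ 1 w) = _
      rw [Tens.smul_tmul, Tens.smul_left, RingHom.id_apply, smul_eq_mul, mul_one]
    | add x y hx hy => simp only [Tens.tmul_add, map_add, hx, hy]
  | add x y hx hy => simp only [map_add, hx, hy]

theorem expand_smul {X W : Type*} [AddCommGroup X] [Module Aᵐᵒᵖ X] [AddCommGroup W]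
    [Module B W] [Module Aᵐᵒᵖ W] [SMulCommClass B Aᵐᵒᵖ W] (a : A)
    (t : Tens α (RingHom.id B) X W) :
    expand α X W (op a • t) = op a • expand α X W t := by
  rw [← collapse_expand t, ← collapse_smul, expand_collapse, collapse_expand]

/-- The right `A`-linear map `X → X ⊗_B D ⊗_B A ≃ X ⊗_A (A ⊗_B D ⊗_B A)` given by `ρ`. -/
def expandLin {X : Type*} [AddCommGroup X] [Module Aᵐᵒᵖ X]
    (ρ : X →ₗ[Aᵐᵒᵖ] Tens α (RingHom.id B) X (Tens (RingHom.id B) α D A)) :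
    X →ₗ[Aᵐᵒᵖ] Tens (RingHom.id A) (RingHom.id A) X (BaseExt α D) where
  toFun x := expand α X (Tens (RingHom.id B) α D A) (ρ x)
  map_add' x y := by rw [map_add, map_add]
  map_smul' a x := by
    rw [map_smul, ← op_unop a, expand_smul]; rfl

theorem collapseLin_expandLin {X : Type*} [AddCommGroup X] [Module Aᵐᵒᵖ X]
    (ρ : X →ₗ[Aᵐᵒᵖ] Tens α (RingHom.id B) X (Tens (RingHom.id B) α D A)) :
    collapseLin (expandLin ρ) = ρ :=
  LinearMap.ext fun x => collapse_expand (ρ x)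

theorem expandLin_collapseLin {X : Type*} [AddCommGroup X] [Module Aᵐᵒᵖ X]
    (φ : X →ₗ[Aᵐᵒᵖ] Tens (RingHom.id A) (RingHom.id A) X (BaseExt α D)) :
    expandLin (collapseLin φ) = φ :=
  LinearMap.ext fun x => expand_collapse (φ x)

/-- The map `d ⊗ e ↦ (1 ⊗ d ⊗ 1) ⊗_A e`. -/
def insertUnits (α : B →+* A) (D : Type*) [AddCommGroup D] [Module B D] [Module Bᵐᵒᵖ D]
    [SMulCommClass B Bᵐᵒᵖ D] :
    Tens (RingHom.id B) α D (BaseExt α D) →+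
      Tens (RingHom.id A) (RingHom.id A) (BaseExt α D) (BaseExt α D) :=
  Tens.lift (fun d e => Tens.tmul _ _ (BaseExt.mk α 1 d 1) e)
    (fun d d' e => by rw [BaseExt.mk, Tens.add_tmul, Tens.tmul_add, Tens.add_tmul])
    (fun d e e' => Tens.tmul_add _ _ _)
    (fun b d e => by
      have h : BaseExt.mk α 1 (op (RingHom.id B b) • d) 1 =
          op (RingHom.id A (α b)) • BaseExt.mk α 1 d 1 := by
        rw [RingHom.id_apply, BaseExt.mk_bal_right]
        simp
      rw [h, Tens.smul_tmul, RingHom.id_apply])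

theorem insertUnits_smul (b : B) (t : Tens (RingHom.id B) α D (BaseExt α D)) :
    insertUnits α D (RingHom.id B b • t) = RingHom.id A (α b) • insertUnits α D t := by
  induction t using Tens.induction_on with
  | pure d e =>
    change Tens.tmul _ _ (BaseExt.mk α 1 (b • d) 1) e =
      Tens.tmul _ _ (BaseExt.mk α (α b * 1) d 1) e
    rw [← BaseExt.mk_bal_left, one_mul, mul_one]
  | add x y hx hy => simp only [smul_add, map_add, hx, hy]

/-- The inverse `x ⊗ (d ⊗ e) ↦ x ⊗ ((1 ⊗ d ⊗ 1) ⊗_A e)` of `collapse₂`. -/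
def expand₂ (α : B →+* A) (D : Type*) [AddCommGroup D] [Module B D] [Module Bᵐᵒᵖ D]
    [SMulCommClass B Bᵐᵒᵖ D] (X : Type*) [AddCommGroup X] [Module Aᵐᵒᵖ X] :
    Tens α (RingHom.id B) X (Tens (RingHom.id B) α D (BaseExt α D)) →+
    Tens (RingHom.id A) (RingHom.id A) X
      (Tens (RingHom.id A) (RingHom.id A) (BaseExt α D) (BaseExt α D)) :=
  Tens.lift (fun x s => Tens.tmul _ _ x (insertUnits α D s))
    (fun x y s => Tens.add_tmul _ _ _)
    (fun x s s' => by rw [map_add, Tens.tmul_add])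
    (fun b x s => by
      rw [insertUnits_smul, ← Tens.smul_tmul]; rfl)

theorem expand₂_collapse₂ {X : Type*} [AddCommGroup X] [Module Aᵐᵒᵖ X]
    (t : Tens (RingHom.id A) (RingHom.id A) X
      (Tens (RingHom.id A) (RingHom.id A) (BaseExt α D) (BaseExt α D))) :
    expand₂ α D X (collapse₂ α D X t) = t := by
  induction t using Tens.induction_on with
  | pure x s =>
    induction s using Tens.induction_on with
    | pure e e' =>
      induction e using BaseExt.induction_on with
      | pure c d a =>
        rw [collapse₂_tmul]
        change Tens.tmul _ _ (op (RingHom.id A c) • x)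
          (Tens.tmul _ _ (BaseExt.mk α 1 d 1) (RingHom.id A a • e')) = _
        rw [Tens.smul_tmul, ← Tens.smul_tmul (f := RingHom.id A) (g := RingHom.id A) a]
        change Tens.tmul _ _ x (Tens.tmul _ _ (BaseExt.mk α (c * 1) d (1 * a)) e') = _
        rw [mul_one, one_mul]
      | add x y hx hy => simp only [Tens.tmul_add, Tens.add_tmul, map_add, hx, hy]
    | add x y hx hy => simp only [Tens.tmul_add, map_add, hx, hy]
  | add x y hx hy => simp only [map_add, hx, hy]

theorem collapse₂_injective (α : B →+* A) (D : Type*) [AddCommGroup D] [Module B D]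
    [Module Bᵐᵒᵖ D] [SMulCommClass B Bᵐᵒᵖ D] (X : Type*) [AddCommGroup X] [Module Aᵐᵒᵖ X] :
    Function.Injective (collapse₂ α D X) :=
  Function.LeftInverse.injective expand₂_collapse₂

theorem mulRight_counitExt_collapse (𝔇 : Coring B D) {X : Type*} [AddCommGroup X]
    [Module Aᵐᵒᵖ X] (s : Tens (RingHom.id A) (RingHom.id A) X (BaseExt α D)) :
    Tens.mulRight α X (Tens.lTensor X (counitExt α 𝔇) (counitExt_smul 𝔇)
      (collapse α X _ s)) =
    Tens.mulRight (RingHom.id A) X (Tens.lTensor X (𝔇.baseExt α).counit.hom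
      (𝔇.baseExt α).counit.map_left s) := by
  induction s using Tens.induction_on with
  | pure y e =>
    induction e using BaseExt.induction_on with
    | pure a d a' =>
      change op (α (𝔇.counit.hom d) * a') • op a • y = op (a * α (𝔇.counit.hom d) * a') • y
      rw [smul_smul, ← op_mul, mul_assoc]
    | add x y hx hy => simp only [Tens.tmul_add, map_add, hx, hy]
  | add x y hx hy => simp only [map_add, hx, hy]

variable {𝔇 : Coring B D} {ℭ : Coring A C}

/-- The `A_α[𝔇]`-comodule `X → X ⊗_B D ⊗_B A ≃ X ⊗_A (A ⊗_B D ⊗_B A)` of a descent datum. -/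
def descToComodObj (γ : CoringHom 𝔇 ℭ α) (X : DescentDatum.{w} γ) :
    Comod.{w} (𝔇.baseExt α) where
  carrier := X.carrier
  coact := expandLin X.ρ
  coassoc x := by
    apply collapse₂_injective α D X.carrier
    refine Eq.trans ?_ (Eq.trans (X.coassoc x) ?_)
    · refine (regroup_collapse (expandLin X.ρ) _).symm.trans ?_
      rw [collapseLin_expandLin]
      exact congrArg (fun t => regroup α D X.carrier (Tens.rTensorLin α (RingHom.id B)
        (Tens (RingHom.id B) α D A) X.ρ t)) (collapse_expand (X.ρ x))
    · refine Eq.trans ?_ (collapse₂_comul 𝔇 _ _).symm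
      exact congrArg (Tens.lTensor X.carrier (comulExt α 𝔇) (comulExt_smul 𝔇))
        (collapse_expand (X.ρ x)).symm
  counit x := by
    refine (mulRight_counitExt_collapse 𝔇 _).symm.trans (Eq.trans ?_ (X.counit x))
    exact congrArg (fun t => Tens.mulRight α X.carrier
      (Tens.lTensor X.carrier (counitExt α 𝔇) (counitExt_smul 𝔇) t)) (collapse_expand (X.ρ x))

theorem expand_rTensorLin {X Y : Type*} [AddCommGroup X] [Module Aᵐᵒᵖ X] [AddCommGroup Y]
    [Module Aᵐᵒᵖ Y] {W : Type*} [AddCommGroup W] [Module B W] (φ : X →ₗ[Aᵐᵒᵖ] Y)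
    (s : Tens α (RingHom.id B) X W) :
    Tens.rTensorLin (RingHom.id A) (RingHom.id A) _ φ (expand α X W s) =
      expand α Y W (Tens.rTensorLin α (RingHom.id B) W φ s) := by
  rw [← expand_collapse (Tens.rTensorLin (RingHom.id A) (RingHom.id A) _ φ _),
    ← collapse_rTensorLin, collapse_expand]

/-- The functor `Desc_(γ,α) ⥤ M^{A_α[𝔇]}` inverse to `comodToDesc`. -/
def descToComod (γ : CoringHom 𝔇 ℭ α) : DescentDatum.{w} γ ⥤ Comod.{w} (𝔇.baseExt α) where
  obj X := descToComodObj γ X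
  map {X Y} φ := ⟨φ.toLin, fun x =>
    (expand_rTensorLin φ.toLin (X.ρ x)).trans
      (congrArg (expand α Y.carrier _) (φ.comm x))⟩

theorem DescentDatum.mk_congr {γ : CoringHom 𝔇 ℭ α} {X : Type w} [AddCommGroup X]
    [Module Aᵐᵒᵖ X]
    {ρ₁ ρ₂ : X →ₗ[Aᵐᵒᵖ] Tens α (RingHom.id B) X (Tens (RingHom.id B) α D A)}
    (hρ : ρ₁ = ρ₂) (h₁ h₁' h₂ h₂') :
    (⟨X, ρ₁, h₁, h₁'⟩ : DescentDatum γ) = ⟨X, ρ₂, h₂, h₂'⟩ := by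
  subst hρ; rfl

theorem Comod.mk_congr {X : Type w} [AddCommGroup X] [Module Aᵐᵒᵖ X]
    {ρ₁ ρ₂ : X →ₗ[Aᵐᵒᵖ] Tens (RingHom.id A) (RingHom.id A) X C}
    (hρ : ρ₁ = ρ₂) (h₁ h₁' h₂ h₂') :
    (⟨X, ρ₁, h₁, h₁'⟩ : Comod ℭ) = ⟨X, ρ₂, h₂, h₂'⟩ := by
  subst hρ; rfl

theorem comodToDescObj_descToComodObj (γ : CoringHom 𝔇 ℭ α) (X : DescentDatum.{w} γ) :
    comodToDescObj γ (descToComodObj γ X) = X :=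
  DescentDatum.mk_congr (collapseLin_expandLin X.ρ) _ _ X.counit X.coassoc

theorem descToComodObj_comodToDescObj (γ : CoringHom 𝔇 ℭ α) (X : Comod.{w} (𝔇.baseExt α)) :
    descToComodObj γ (comodToDescObj γ X) = X :=
  Comod.mk_congr (expandLin_collapseLin X.coact) _ _ X.coassoc X.counit

/-- Morphisms of descent data with the same underlying map agree up to an equality of the
descent data that is the identity on carriers. -/
theorem DescentDatum.Hom.heq {γ : CoringHom 𝔇 ℭ α} {X Y : Type w} [AddCommGroup X]
    [Module Aᵐᵒᵖ X] [AddCommGroup Y] [Module Aᵐᵒᵖ Y]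
    {ρ₁ ρ₂ : X →ₗ[Aᵐᵒᵖ] Tens α (RingHom.id B) X (Tens (RingHom.id B) α D A)}
    {σ₁ σ₂ : Y →ₗ[Aᵐᵒᵖ] Tens α (RingHom.id B) Y (Tens (RingHom.id B) α D A)}
    (hρ : ρ₁ = ρ₂) (hσ : σ₁ = σ₂) {h₁ h₁' h₂ h₂' k₁ k₁' k₂ k₂'} (φ : X →ₗ[Aᵐᵒᵖ] Y) (c₁ c₂) :
    HEq (⟨φ, c₁⟩ : DescentDatum.Hom (γ := γ) ⟨X, ρ₁, h₁, h₁'⟩ ⟨Y, σ₁, k₁, k₁'⟩)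
      (⟨φ, c₂⟩ : DescentDatum.Hom (γ := γ) ⟨X, ρ₂, h₂, h₂'⟩ ⟨Y, σ₂, k₂, k₂'⟩) := by
  subst hρ hσ; rfl

/-- Colinear maps with the same underlying map agree up to an equality of comodules that is the
identity on carriers. -/
theorem Comod.Hom.heq {X Y : Type w} [AddCommGroup X]
    [Module Aᵐᵒᵖ X] [AddCommGroup Y] [Module Aᵐᵒᵖ Y]
    {ρ₁ ρ₂ : X →ₗ[Aᵐᵒᵖ] Tens (RingHom.id A) (RingHom.id A) X C}
    {σ₁ σ₂ : Y →ₗ[Aᵐᵒᵖ] Tens (RingHom.id A) (RingHom.id A) Y C}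
    (hρ : ρ₁ = ρ₂) (hσ : σ₁ = σ₂) {h₁ h₁' h₂ h₂' k₁ k₁' k₂ k₂'} (φ : X →ₗ[Aᵐᵒᵖ] Y) (c₁ c₂) :
    HEq (⟨φ, c₁⟩ : Comod.Hom (ℭ := ℭ) ⟨X, ρ₁, h₁, h₁'⟩ ⟨Y, σ₁, k₁, k₁'⟩)
      (⟨φ, c₂⟩ : Comod.Hom (ℭ := ℭ) ⟨X, ρ₂, h₂, h₂'⟩ ⟨Y, σ₂, k₂, k₂'⟩) := by
  subst hρ hσ; rfl

theorem descToComod_comp_comodToDesc (γ : CoringHom 𝔇 ℭ α) :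
    descToComod γ ⋙ comodToDesc γ = 𝟭 (DescentDatum.{w} γ) :=
  CategoryTheory.Functor.hext (comodToDescObj_descToComodObj γ) fun X Y φ =>
    DescentDatum.Hom.heq (collapseLin_expandLin X.ρ) (collapseLin_expandLin Y.ρ) φ.toLin _ _

theorem comodToDesc_comp_descToComod (γ : CoringHom 𝔇 ℭ α) :
    comodToDesc γ ⋙ descToComod γ = 𝟭 (Comod.{w} (𝔇.baseExt α)) :=
  CategoryTheory.Functor.hext (descToComodObj_comodToDescObj γ) fun X Y φ =>
    Comod.Hom.heq (expandLin_collapseLin X.coact) (expandLin_collapseLin Y.coact) φ.toLin _ _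

theorem comodToDesc_isEquivalence (γ : CoringHom 𝔇 ℭ α) :
    (comodToDesc.{w} γ).IsEquivalence :=
  (CategoryTheory.Equivalence.mk (comodToDesc γ) (descToComod γ)
    (eqToIso (comodToDesc_comp_descToComod γ).symm)
    (eqToIso (descToComod_comp_comodToDesc γ))).isEquivalence_functor

end InverseFunctor

end CoringDescent

/-! ### Associativity and exactness of tensor products -/

namespace CoringDescent

namespace Tens

section Assoc

variable {B R S C T U : Type*} [Ring B] [Ring R] [Ring S] [Ring C] [Ring T] [Ring U]
  {f : B →+* R} {g : B →+* S} {f₁ : C →+* T} {g₁ : C →+* U}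
  {M N K : Type*} [AddCommGroup M] [Module Rᵐᵒᵖ M] [AddCommGroup N] [Module S N]
  [Module Tᵐᵒᵖ N] [SMulCommClass S Tᵐᵒᵖ N] [AddCommGroup K] [Module U K]

/-- The inverse `m ⊗ (n ⊗ k) ↦ (m ⊗ n) ⊗ k` of `Tens.assoc`. -/
def assocInv (f : B →+* R) (g : B →+* S) (f₁ : C →+* T) (g₁ : C →+* U) (M N K : Type*)
    [AddCommGroup M] [Module Rᵐᵒᵖ M] [AddCommGroup N] [Module S N] [Module Tᵐᵒᵖ N]
    [SMulCommClass S Tᵐᵒᵖ N] [AddCommGroup K] [Module U K] :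
    Tens f g M (Tens f₁ g₁ N K) →+ Tens f₁ g₁ (Tens f g M N) K :=
  lift
    (fun m t => lift (f := f₁) (g := g₁) (fun n k => tmul f₁ g₁ (tmul f g m n) k)
      (fun n n' k => by rw [tmul_add, add_tmul]) (fun n k k' => tmul_add _ _ _)
      (fun c n k => by rw [← smul_tmul, smul_right]) t)
    (fun m m' t => by
      induction t using Tens.induction_on with
      | pure n k => simp only [lift_tmul, add_tmul]
      | add x y hx hy => simp only [map_add, hx, hy]; abel)
    (fun m t t' => map_add _ _ _)
    (fun b m t => by
      induction t using Tens.induction_on with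
      | pure n k => simp only [smul_left, lift_tmul, smul_tmul]
      | add x y hx hy => simp only [smul_add, map_add, hx, hy])

theorem assocInv_assoc (t : Tens f₁ g₁ (Tens f g M N) K) :
    assocInv f g f₁ g₁ M N K (assoc f g f₁ g₁ M N K t) = t := by
  induction t using Tens.induction_on with
  | pure s k =>
    induction s using Tens.induction_on with
    | pure m n => rfl
    | add x y hx hy => simp only [add_tmul, map_add, hx, hy]
  | add x y hx hy => simp only [map_add, hx, hy]

theorem assoc_assocInv (t : Tens f g M (Tens f₁ g₁ N K)) :
    assoc f g f₁ g₁ M N K (assocInv f g f₁ g₁ M N K t) = t := by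
  induction t using Tens.induction_on with
  | pure m s =>
    induction s using Tens.induction_on with
    | pure n k => rfl
    | add x y hx hy => simp only [tmul_add, map_add, hx, hy]
  | add x y hx hy => simp only [map_add, hx, hy]

theorem assoc_injective : Function.Injective (assoc f g f₁ g₁ M N K) :=
  Function.LeftInverse.injective assocInv_assoc

end Assoc

section Functoriality

variable {B R S : Type*} [Ring B] [Ring R] [Ring S] (f : B →+* R) (g : B →+* S)
  {M M' M'' : Type*} [AddCommGroup M] [Module Rᵐᵒᵖ M] [AddCommGroup M'] [Module Rᵐᵒᵖ M']
  [AddCommGroup M''] [Module Rᵐᵒᵖ M''] (N : Type*) [AddCommGroup N] [Module S N]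

theorem rTensorLin_comp (ψ : M' →ₗ[Rᵐᵒᵖ] M'') (φ : M →ₗ[Rᵐᵒᵖ] M') (t : Tens f g M N) :
    rTensorLin f g N (ψ ∘ₗ φ) t = rTensorLin f g N ψ (rTensorLin f g N φ t) := by
  induction t using Tens.induction_on with
  | pure m n => rfl
  | add x y hx hy => simp only [map_add, hx, hy]

theorem rTensorLin_id (t : Tens f g M N) : rTensorLin f g N LinearMap.id t = t := by
  induction t using Tens.induction_on with
  | pure m n => rfl
  | add x y hx hy => simp only [map_add, hx, hy]

theorem rTensorLin_sub (φ ψ : M →ₗ[Rᵐᵒᵖ] M') (t : Tens f g M N) :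
    rTensorLin f g N (φ - ψ) t = rTensorLin f g N φ t - rTensorLin f g N ψ t := by
  induction t using Tens.induction_on with
  | pure m n =>
    rw [eq_sub_iff_add_eq, rTensorLin_tmul, rTensorLin_tmul, rTensorLin_tmul, ← add_tmul,
      LinearMap.sub_apply, sub_add_cancel]
  | add x y hx hy => simp only [map_add, hx, hy]; abel

/-- `φ ⊗_B N` as a right linear map, for a right action on `N`. -/
def rTensorRight {Q : Type*} [Ring Q] [Module Qᵐᵒᵖ N] [SMulCommClass S Qᵐᵒᵖ N]
    (φ : M →ₗ[Rᵐᵒᵖ] M') : Tens f g M N →ₗ[Qᵐᵒᵖ] Tens f g M' N :=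
  { rTensorLin f g N φ with
    map_smul' := fun q t => by
      change rTensorLin f g N φ _ = q • rTensorLin f g N φ _
      induction t using Tens.induction_on with
      | pure m n => rfl
      | add x y hx hy => simp only [smul_add, map_add, hx, hy] }

/-- Right exactness of `- ⊗_B N`, for a surjection. -/
theorem exists_of_rTensorLin_eq_zero {φ : M →ₗ[Rᵐᵒᵖ] M'} (hφ : Function.Surjective φ)
    {t : Tens f g M N} (ht : rTensorLin f g N φ t = 0) :
    ∃ s, rTensorLin f g N (LinearMap.ker φ).subtype s = t := by
  let I : AddSubgroup (Tens f g M N) := (rTensorLin f g N (LinearMap.ker φ).subtype).range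
  let σ := Function.surjInv hφ
  have key : ∀ (m m' : M) (n : N), φ m = φ m' →
      (QuotientAddGroup.mk (tmul f g m n) : Tens f g M N ⧸ I) =
        QuotientAddGroup.mk (tmul f g m' n) := by
    intro m m' n h
    refine QuotientAddGroup.eq.2 ⟨tmul f g ⟨-m + m', ?_⟩ n, ?_⟩
    · rw [LinearMap.mem_ker, map_add, map_neg, h, neg_add_cancel]
    · rw [rTensorLin_tmul, eq_neg_add_iff_add_eq, ← add_tmul, Submodule.subtype_apply,
        add_neg_cancel_left]
  -- A set-theoretic section of `φ` induces an inverse of `(M ⊗ N) / (ker φ ⊗ N) → M' ⊗ N`.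
  let G : Tens f g M' N →+ Tens f g M N ⧸ I :=
    Tens.lift (fun z n => QuotientAddGroup.mk (tmul f g (σ z) n))
      (fun z z' n => by
        rw [← QuotientAddGroup.mk_add, ← add_tmul]
        refine key _ _ _ ?_
        simp only [σ, map_add, Function.surjInv_eq])
      (fun z n n' => by rw [tmul_add, QuotientAddGroup.mk_add])
      (fun b z n => by
        rw [← smul_tmul]
        refine key _ _ _ ?_
        simp only [σ, map_smul, Function.surjInv_eq])
  have hG : ∀ s : Tens f g M N, G (rTensorLin f g N φ s) = QuotientAddGroup.mk s := by
    intro s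
    induction s using Tens.induction_on with
    | pure m n => exact key _ _ _ (Function.surjInv_eq hφ _)
    | add x y hx hy => rw [map_add, map_add, hx, hy, QuotientAddGroup.mk_add]
  have := hG t
  rw [ht, map_zero] at this
  exact (QuotientAddGroup.eq_zero_iff t).1 this.symm

end Functoriality

end Tens

/-- Tensoring with a flat left module preserves kernels. -/
theorem IsLeftFlat.exact_ker {B : Type u} {S : Type*} [Ring B] [Ring S] {g : B →+* S}
    {N : Type*} [AddCommGroup N] [Module S N] (h : IsLeftFlat g N) {X Y : Type u}
    [AddCommGroup X] [Module Bᵐᵒᵖ X] [AddCommGroup Y] [Module Bᵐᵒᵖ Y] (φ : X →ₗ[Bᵐᵒᵖ] Y)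
    {t : Tens (RingHom.id B) g X N} (ht : Tens.rTensorLin (RingHom.id B) g N φ t = 0) :
    ∃ s, Tens.rTensorLin (RingHom.id B) g N (LinearMap.ker φ).subtype s = t := by
  have h0 : Tens.rTensorLin (RingHom.id B) g N φ.rangeRestrict t = 0 := by
    apply h _ _ (LinearMap.range φ).subtype Subtype.val_injective
    rw [← Tens.rTensorLin_comp, map_zero]
    exact ht
  have := Tens.exists_of_rTensorLin_eq_zero (RingHom.id B) g N φ.surjective_rangeRestrict h0
  rwa [LinearMap.ker_rangeRestrict] at this

/-- Tensoring with a faithfully flat left module preserves and reflects injectivity. -/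
theorem IsLeftFaithfullyFlat.injective_iff {B : Type u} {S : Type*} [Ring B] [Ring S]
    {g : B →+* S} {N : Type*} [AddCommGroup N] [Module S N] (h : IsLeftFaithfullyFlat g N)
    {X Y : Type u} [AddCommGroup X] [Module Bᵐᵒᵖ X] [AddCommGroup Y] [Module Bᵐᵒᵖ Y]
    (φ : X →ₗ[Bᵐᵒᵖ] Y) :
    Function.Injective φ ↔ Function.Injective (Tens.rTensorLin (RingHom.id B) g N φ) := by
  have hz : ∀ s, Tens.rTensorLin (RingHom.id B) g N (0 : PUnit.{u + 1} →ₗ[Bᵐᵒᵖ] X) s = 0 := by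
    intro s
    induction s using Tens.induction_on with
    | pure m n =>
      rw [Tens.rTensorLin_tmul, LinearMap.zero_apply, ← add_left_inj, ← Tens.add_tmul, add_zero,
        zero_add]
    | add x y hx hy => rw [map_add, hx, hy, add_zero]
  have := h PUnit.{u + 1} X Y 0 φ
  rw [injective_iff_map_eq_zero, injective_iff_map_eq_zero]
  constructor
  · intro hi t ht
    have he : Function.Exact (0 : PUnit.{u + 1} →ₗ[Bᵐᵒᵖ] X) φ := fun x =>
      ⟨fun hx => ⟨0, (hi x hx).symm⟩, by rintro ⟨y, rfl⟩; exact map_zero φ⟩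
    obtain ⟨s, rfl⟩ := (this.1 he t).1 ht
    exact hz s
  · intro hi x hx
    have he : Function.Exact (0 : PUnit.{u + 1} →ₗ[Bᵐᵒᵖ] X) φ := this.2 fun t =>
      ⟨fun ht => ⟨0, by rw [map_zero, hi t ht]⟩, by rintro ⟨y, rfl⟩; rw [hz, map_zero]⟩
    obtain ⟨y, rfl⟩ := (he x).1 hx
    rfl

theorem exists_comp_eq_of_injective {R M N Y : Type*} [Ring R] [AddCommGroup M]
    [Module R M] [AddCommGroup N] [Module R N] [AddCommGroup Y] [Module R Y] {ι : N →ₗ[R] Y}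
    (hι : Function.Injective ι) (h : M →ₗ[R] Y) (hmem : ∀ m, ∃ n, ι n = h m) :
    ∃ g : M →ₗ[R] N, ι ∘ₗ g = h :=
  ⟨(LinearEquiv.ofInjective ι hι).symm.toLinearMap ∘ₗ
      h.codRestrict (LinearMap.range ι) hmem,
    LinearMap.ext fun _ => congrArg Subtype.val
      ((LinearEquiv.ofInjective ι hι).apply_symm_apply _)⟩

end CoringDescent

/-! ### The defect of a descent datum -/

namespace CoringDescent

section Cofork

variable {A B : Type*} [Ring A] [Ring B] {α : B →+* A}
  {D : Type*} [AddCommGroup D] [Module B D] [Module Bᵐᵒᵖ D] [SMulCommClass B Bᵐᵒᵖ D]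
  {C : Type*} [AddCommGroup C] [Module A C] [Module Aᵐᵒᵖ C] [SMulCommClass A Aᵐᵒᵖ C]
  {X : Type*} [AddCommGroup X] [Module Aᵐᵒᵖ X]

/-- The map `d₁ ⊗ d₂ ↦ (x ⊗ (d₁ ⊗ 1)) ⊗ d₂`. -/
def insertOne (α : B →+* A) (x : X) : Tens (RingHom.id B) (RingHom.id B) D D →+
    Tens α (RingHom.id B) (Tens α (RingHom.id B) X (Tens (RingHom.id B) α D A)) D :=
  Tens.lift (fun d₁ d₂ => Tens.tmul _ _ (Tens.tmul _ _ x (Tens.tmul _ _ d₁ 1)) d₂)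
    (fun d d' e => by rw [Tens.add_tmul, Tens.tmul_add, Tens.add_tmul])
    (fun d e e' => Tens.tmul_add _ _ _)
    (fun b d e => by
      rw [← Tens.smul_tmul, Tens.smul_tmul, Tens.smul_right, Tens.smul_right, smul_eq_mul,
        op_smul_eq_mul, mul_one, one_mul])

/-- The right `B`-linear map `x ⊗ d ↦ ∑ (x ⊗ (d₁ ⊗ 1)) ⊗ d₂`. -/
def insertComul (α : B →+* A) (𝔇 : Coring B D) (X : Type*) [AddCommGroup X] [Module Aᵐᵒᵖ X] :
    Tens α (RingHom.id B) X D →ₗ[Bᵐᵒᵖ]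
      Tens α (RingHom.id B) (Tens α (RingHom.id B) X (Tens (RingHom.id B) α D A)) D :=
  let F := Tens.lift (f := α) (g := RingHom.id B)
    (fun (x : X) d => insertOne α x (𝔇.comul.hom d))
    (fun x x' d => by
      generalize 𝔇.comul.hom d = s
      induction s using Tens.induction_on with
      | pure d e => simp only [insertOne, Tens.lift_tmul, Tens.add_tmul]
      | add x y hx hy => simp only [map_add, hx, hy]; abel)
    (fun x d d' => by rw [map_add, map_add])
    (fun b x d => by
      rw [𝔇.comul.map_left]
      generalize 𝔇.comul.hom d = s
      induction s using Tens.induction_on with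
      | pure d e =>
        simp only [insertOne, Tens.lift_tmul, Tens.smul_left, RingHom.id_apply, Tens.smul_tmul]
      | add x y hx hy => simp only [smul_add, map_add, hx, hy])
  { F with
    map_smul' := fun q t => by
      change F _ = q • F _
      induction t using Tens.induction_on with
      | pure x d =>
        change insertOne α x (𝔇.comul.hom (q • d)) = q • insertOne α x (𝔇.comul.hom d)
        have h := 𝔇.comul.map_right (unop q) d
        rw [op_unop] at h
        rw [h, RingHom.id_apply, op_unop]
        generalize 𝔇.comul.hom d = s
        induction s using Tens.induction_on with
        | pure d e => rfl
        | add x y hx hy => simp only [smul_add, map_add, hx, hy]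
      | add x y hx hy => simp only [smul_add, map_add, hx, hy] }

theorem insertComul_tmul (𝔇 : Coring B D) (x : X) (d : D) :
    insertComul α 𝔇 X (Tens.tmul _ _ x d) = insertOne α x (𝔇.comul.hom d) := rfl

/-- The contraction `x ⊗ (d ⊗ a) ↦ x · (ε(d) a)`. -/
def contract (α : B →+* A) (𝔇 : Coring B D) (X : Type*) [AddCommGroup X] [Module Aᵐᵒᵖ X] :
    Tens α (RingHom.id B) X (Tens (RingHom.id B) α D A) →+ X :=
  (Tens.mulRight α X).comp (Tens.lTensor X (counitExt α 𝔇) (counitExt_smul 𝔇))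

theorem contract_tmul (𝔇 : Coring B D) (x : X) (d : D) (a : A) :
    contract α 𝔇 X (Tens.tmul _ _ x (Tens.tmul _ _ d a)) =
      op (α (𝔇.counit.hom d) * a) • x := rfl

theorem contract_rTensorLin (𝔇 : Coring B D) {Y : Type*} [AddCommGroup Y] [Module Aᵐᵒᵖ Y]
    (φ : X →ₗ[Aᵐᵒᵖ] Y) (t : Tens α (RingHom.id B) X (Tens (RingHom.id B) α D A)) :
    contract α 𝔇 Y (Tens.rTensorLin α (RingHom.id B) _ φ t) = φ (contract α 𝔇 X t) := by
  induction t using Tens.induction_on with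
  | pure x s =>
    induction s using Tens.induction_on with
    | pure d c =>
      rw [Tens.rTensorLin_tmul, contract_tmul, contract_tmul, map_smul]
    | add x y hx hy => simp only [Tens.tmul_add, map_add, hx, hy]
  | add x y hx hy => simp only [map_add, hx, hy]

/-- Contracting the last two factors of `∑ (x ⊗ (d₁ ⊗ 1)) ⊗ (d₂ ⊗ a)` gives back
`x ⊗ (d ⊗ a)`. -/
theorem contract_insertComul (𝔇 : Coring B D)
    (s : Tens (RingHom.id B) α (Tens α (RingHom.id B) X D) A) :
    contract α 𝔇 _ (Tens.assoc _ _ _ _ _ D A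
      (Tens.rTensorLin (RingHom.id B) α A (insertComul α 𝔇 X) s)) =
    Tens.assoc _ _ _ _ X D A s := by
  induction s using Tens.induction_on with
  | pure t a =>
    induction t using Tens.induction_on with
    | pure x d =>
      rw [Tens.rTensorLin_tmul, insertComul_tmul, Tens.assoc_tmul]
      conv_rhs => rw [← 𝔇.counit_right d]
      generalize 𝔇.comul.hom d = s
      induction s using Tens.induction_on with
      | pure d₁ d₂ =>
        change Tens.tmul _ _ x (Tens.tmul _ _ d₁ (1 * (α (𝔇.counit.hom d₂) * a))) =
          Tens.tmul _ _ x (Tens.tmul _ _ (op (RingHom.id B (𝔇.counit.hom d₂)) • d₁) a)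
        rw [Tens.smul_tmul, one_mul, smul_eq_mul]
      | add x y hx hy => simp only [Tens.add_tmul, Tens.tmul_add, map_add, hx, hy]
    | add x y hx hy => simp only [Tens.add_tmul, map_add, hx, hy]
  | add x y hx hy => simp only [map_add, hx, hy]

/-- Up to associativity, `insertComul` tensored with `A` is the right-hand side of the
coassociativity condition on descent data. -/
theorem regroup_insertComul (𝔇 : Coring B D)
    (s : Tens (RingHom.id B) α (Tens α (RingHom.id B) X D) A) :
    regroup α D X (Tens.assoc _ _ _ _ _ D A
      (Tens.rTensorLin (RingHom.id B) α A (insertComul α 𝔇 X) s)) =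
    Tens.lTensor X (comulExt α 𝔇) (comulExt_smul 𝔇) (Tens.assoc _ _ _ _ X D A s) := by
  induction s using Tens.induction_on with
  | pure t a =>
    induction t using Tens.induction_on with
    | pure x d =>
      rw [Tens.rTensorLin_tmul, insertComul_tmul, Tens.assoc_tmul, Tens.map_tmul,
        comulExt_tmul]
      generalize 𝔇.comul.hom d = s
      induction s using Tens.induction_on with
      | pure d₁ d₂ => rfl
      | add x y hx hy => simp only [Tens.add_tmul, Tens.tmul_add, map_add, hx, hy]
    | add x y hx hy => simp only [Tens.add_tmul, map_add, hx, hy]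
  | add x y hx hy => simp only [map_add, hx, hy]

/-- `(φ ⊗_B D) ⊗_B A` is `φ ⊗_B (D ⊗_B A)`. -/
theorem assoc_rTensorRight {Y : Type*} [AddCommGroup Y] [Module Aᵐᵒᵖ Y]
    (φ : X →ₗ[Aᵐᵒᵖ] Y) (s : Tens (RingHom.id B) α (Tens α (RingHom.id B) X D) A) :
    Tens.assoc _ _ _ _ Y D A (Tens.rTensorLin (RingHom.id B) α A
      (Tens.rTensorRight α (RingHom.id B) D φ) s) =
    Tens.rTensorLin α (RingHom.id B) _ φ (Tens.assoc _ _ _ _ X D A s) := by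
  induction s using Tens.induction_on with
  | pure t a =>
    induction t using Tens.induction_on with
    | pure x d => rfl
    | add x y hx hy => simp only [Tens.add_tmul, map_add, hx, hy]
  | add x y hx hy => simp only [map_add, hx, hy]

theorem regroup_injective :
    Function.Injective (regroup α D X) := by
  let G : Tens α (RingHom.id B) X (Tens (RingHom.id B) α D (BaseExt α D)) →+ _ :=
    (Tens.assocInv α (RingHom.id B) α (RingHom.id B) X (Tens (RingHom.id B) α D A)
      (Tens (RingHom.id B) α D A)).comp
    (Tens.lTensor X (Tens.assocInv _ _ _ _ D A (Tens (RingHom.id B) α D A)) (fun b t => by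
      induction t using Tens.induction_on with
      | pure u w =>
        induction w using Tens.induction_on with
        | pure d a => rfl
        | add x y hx hy => simp only [Tens.tmul_add, smul_add, map_add, hx, hy]
      | add x y hx hy => simp only [smul_add, map_add, hx, hy]))
  refine Function.LeftInverse.injective (g := G) fun t => ?_
  induction t using Tens.induction_on with
  | pure u w =>
    induction u using Tens.induction_on with
    | pure x s =>
      induction s using Tens.induction_on with
      | pure d a => rfl
      | add x y hx hy => simp only [Tens.tmul_add, Tens.add_tmul, map_add, hx, hy]
    | add x y hx hy => simp only [Tens.add_tmul, map_add, hx, hy]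
  | add x y hx hy => simp only [map_add, hx, hy]

variable {𝔇 : Coring B D} {ℭ : Coring A C} {γ : CoringHom 𝔇 ℭ α}

/-- The difference `ρ ⊗_B D - (x ⊗ d ↦ ∑ (x ⊗ (d₁ ⊗ 1)) ⊗ d₂)` of the two maps
`X ⊗_B D → (X ⊗_B (D ⊗_B A)) ⊗_B D` attached to a descent datum.  Its kernel is the cotensor
product `X □ (A ⊗_B D)` over `A_α[𝔇]`. -/
def DescentDatum.defect (X : DescentDatum.{w} γ) : Tens α (RingHom.id B) X.carrier D →ₗ[Bᵐᵒᵖ]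
    Tens α (RingHom.id B)
      (Tens α (RingHom.id B) X.carrier (Tens (RingHom.id B) α D A)) D :=
  Tens.rTensorRight α (RingHom.id B) D X.ρ - insertComul α 𝔇 X.carrier

theorem DescentDatum.contract_ρ (X : DescentDatum.{w} γ) (x : X.carrier) :
    contract α 𝔇 X.carrier (X.ρ x) = x :=
  X.counit x

/-- After applying `- ⊗_B A`, the kernel of the defect is the image of the coaction: the
resulting sequence is split by the counit of `𝔇`. -/
theorem DescentDatum.rTensorLin_defect_eq_zero_iff (X : DescentDatum.{w} γ)
    (s : Tens (RingHom.id B) α (Tens α (RingHom.id B) X.carrier D) A) :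
    Tens.rTensorLin (RingHom.id B) α A X.defect s = 0 ↔
      ∃ x, X.ρ x = Tens.assoc _ _ _ _ X.carrier D A s := by
  rw [DescentDatum.defect, Tens.rTensorLin_sub, sub_eq_zero]
  constructor
  · intro h
    have h' := congrArg (fun t => contract α 𝔇 _ (Tens.assoc _ _ _ _ _ D A t)) h
    simp only [contract_insertComul, assoc_rTensorRight, contract_rTensorLin] at h'
    exact ⟨_, h'⟩
  · rintro ⟨x, hx⟩
    apply Tens.assoc_injective
    apply regroup_injective
    rw [regroup_insertComul, assoc_rTensorRight, ← hx]
    exact X.coassoc x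

end Cofork

section Unit

variable {A B : Type*} [Ring A] [Ring B] {α : B →+* A}
  {D : Type*} [AddCommGroup D] [Module B D] [Module Bᵐᵒᵖ D] [SMulCommClass B Bᵐᵒᵖ D]
  {C : Type*} [AddCommGroup C] [Module A C] [Module Aᵐᵒᵖ C] [SMulCommClass A Aᵐᵒᵖ C]

/-- The right `B`-linear map `n ⊗ d ↦ (n ⊗ 1) ⊗ d`. -/
def unitInsert (α : B →+* A) (N D : Type*) [AddCommGroup N] [Module Bᵐᵒᵖ N]
    [AddCommGroup D] [Module B D] [Module Bᵐᵒᵖ D] [SMulCommClass B Bᵐᵒᵖ D] :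
    Tens (RingHom.id B) (RingHom.id B) N D →ₗ[Bᵐᵒᵖ]
      Tens α (RingHom.id B) (Tens (RingHom.id B) α N A) D :=
  let F := Tens.lift (f := RingHom.id B) (g := RingHom.id B)
    (fun (n : N) (d : D) => Tens.tmul α (RingHom.id B) (Tens.tmul (RingHom.id B) α n (1 : A)) d)
    (fun x y z => by rw [Tens.add_tmul, Tens.add_tmul])
    (fun x y z => Tens.tmul_add _ _ _)
    (fun b n d => by
      rw [← Tens.smul_tmul, Tens.smul_tmul, Tens.smul_right, smul_eq_mul, op_smul_eq_mul,
        mul_one, one_mul])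
  { F with
    map_smul' := fun q t => by
      change F _ = q • F _
      induction t using Tens.induction_on with
      | pure x d => rfl
      | add x y hx hy => simp only [smul_add, map_add, hx, hy] }

theorem unitInsert_tmul {N : Type*} [AddCommGroup N] [Module Bᵐᵒᵖ N] (n : N) (d : D) :
    unitInsert α N D (Tens.tmul _ _ n d) = Tens.tmul _ _ (Tens.tmul _ _ n 1) d := rfl

theorem unitInsert_rTensorLin {M N : Type*} [AddCommGroup M] [Module Bᵐᵒᵖ M] [AddCommGroup N]
    [Module Bᵐᵒᵖ N] (φ : M →ₗ[Bᵐᵒᵖ] N) (s : Tens (RingHom.id B) (RingHom.id B) M D) :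
    unitInsert α N D (Tens.rTensorLin (RingHom.id B) (RingHom.id B) D φ s) =
      Tens.rTensorLin α (RingHom.id B) D (pushMap α φ) (unitInsert α M D s) := by
  induction s using Tens.induction_on with
  | pure m d => rfl
  | add x y hx hy => simp only [map_add, hx, hy]

/-- The coaction `x ⊗ d ↦ ∑ (x ⊗ d₁) ⊗ d₂` of `𝔇` on `X ⊗_B D`. -/
def cofreeCoact {R : Type*} [Ring R] (f : B →+* R) (𝔇 : Coring B D) (X : Type*)
    [AddCommGroup X] [Module Rᵐᵒᵖ X] :
    Tens f (RingHom.id B) X D →ₗ[Bᵐᵒᵖ]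
      Tens (RingHom.id B) (RingHom.id B) (Tens f (RingHom.id B) X D) D :=
  let F := (Tens.assocInv f (RingHom.id B) (RingHom.id B) (RingHom.id B) X D D).comp
    (Tens.lTensor X 𝔇.comul.hom 𝔇.comul.map_left)
  { F with
    map_smul' := fun q t => by
      change F _ = q • F _
      induction t using Tens.induction_on with
      | pure x d =>
        change Tens.assocInv _ _ _ _ X D D (Tens.tmul _ _ x (𝔇.comul.hom (q • d))) =
          q • Tens.assocInv _ _ _ _ X D D (Tens.tmul _ _ x (𝔇.comul.hom d))
        have h := 𝔇.comul.map_right (unop q) d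
        rw [op_unop] at h
        rw [h, RingHom.id_apply, op_unop]
        generalize 𝔇.comul.hom d = s
        induction s using Tens.induction_on with
        | pure d e => rfl
        | add x y hx hy => simp only [Tens.tmul_add, smul_add, map_add, hx, hy]
      | add x y hx hy => simp only [smul_add, map_add, hx, hy] }

theorem cofreeCoact_tmul {R : Type*} [Ring R] (f : B →+* R) (𝔇 : Coring B D) {X : Type*}
    [AddCommGroup X] [Module Rᵐᵒᵖ X] (x : X) (d : D) :
    cofreeCoact f 𝔇 X (Tens.tmul _ _ x d) =
      Tens.assocInv _ _ _ _ X D D (Tens.tmul _ _ x (𝔇.comul.hom d)) := rfl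

theorem cofreeCoact_rTensorLin {R : Type*} [Ring R] (f : B →+* R) (𝔇 : Coring B D)
    {X Y : Type*} [AddCommGroup X] [Module Rᵐᵒᵖ X] [AddCommGroup Y] [Module Rᵐᵒᵖ Y]
    (φ : X →ₗ[Rᵐᵒᵖ] Y) (t : Tens f (RingHom.id B) X D) :
    cofreeCoact f 𝔇 Y (Tens.rTensorLin f (RingHom.id B) D φ t) =
      Tens.rTensorLin (RingHom.id B) (RingHom.id B) D
        (Tens.rTensorRight f (RingHom.id B) D φ) (cofreeCoact f 𝔇 X t) := by
  induction t using Tens.induction_on with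
  | pure x d =>
    change Tens.assocInv _ _ _ _ Y D D (Tens.tmul _ _ (φ x) (𝔇.comul.hom d)) =
      Tens.rTensorLin (RingHom.id B) (RingHom.id B) D
        (Tens.rTensorRight f (RingHom.id B) D φ)
        (Tens.assocInv _ _ _ _ X D D (Tens.tmul _ _ x (𝔇.comul.hom d)))
    generalize 𝔇.comul.hom d = s
    induction s using Tens.induction_on with
    | pure d e => rfl
    | add x y hx hy => simp only [Tens.tmul_add, map_add, hx, hy]
  | add x y hx hy => simp only [map_add, hx, hy]

variable {𝔇 : Coring B D} {ℭ : Coring A C} {γ : CoringHom 𝔇 ℭ α}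

/-- The right `B`-linear map `N → (N ⊗_B A) ⊗_B D`, `n ↦ ∑ (n₀ ⊗ 1) ⊗ n₁`, for a
`𝔇`-comodule `N`. -/
def Comod.embed (α : B →+* A) (N : Comod.{w} 𝔇) :
    N.carrier →ₗ[Bᵐᵒᵖ] Tens α (RingHom.id B) (Tens (RingHom.id B) α N.carrier A) D :=
  unitInsert α N.carrier D ∘ₗ N.coact

/-- `N → (N ⊗_B A) ⊗_B D` is colinear, where `D` coacts on the right factor only. -/
theorem Comod.rTensorLin_embed (N : Comod.{w} 𝔇) (n : N.carrier) :
    Tens.rTensorLin (RingHom.id B) (RingHom.id B) D (N.embed α) (N.coact n) =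
      cofreeCoact α 𝔇 _ (N.embed α n) := by
  have h := congrArg (Tens.assocInv _ _ _ _ N.carrier D D) (N.coassoc n)
  rw [Tens.assocInv_assoc] at h
  have h1 := congrArg (Tens.rTensorLin (RingHom.id B) (RingHom.id B) D
    (unitInsert α N.carrier D)) h
  rw [← Tens.rTensorLin_comp] at h1
  refine h1.trans ?_
  change _ = cofreeCoact α 𝔇 _ (unitInsert α N.carrier D (N.coact n))
  generalize N.coact n = s
  induction s using Tens.induction_on with
  | pure m d =>
    rw [unitInsert_tmul]
    change Tens.rTensorLin (RingHom.id B) (RingHom.id B) D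
      (unitInsert α N.carrier D) (Tens.assocInv _ _ _ _ N.carrier D D
        (Tens.tmul _ _ m (𝔇.comul.hom d))) =
      Tens.assocInv _ _ _ _ _ D D (Tens.tmul _ _ (Tens.tmul _ _ m (1 : A)) (𝔇.comul.hom d))
    generalize 𝔇.comul.hom d = s
    induction s using Tens.induction_on with
    | pure d e => rfl
    | add x y hx hy => simp only [Tens.tmul_add, map_add, hx, hy]
  | add x y hx hy => simp only [map_add, hx, hy]

end Unit

end CoringDescent

/-! ### Full faithfulness of `- ⊗_B A` -/

namespace CoringDescent

section Descent

variable {A B D : Type u} [Ring A] [Ring B] {α : B →+* A}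
  [AddCommGroup D] [Module B D] [Module Bᵐᵒᵖ D] [SMulCommClass B Bᵐᵒᵖ D]
  {C : Type v} [AddCommGroup C] [Module A C] [Module Aᵐᵒᵖ C] [SMulCommClass A Aᵐᵒᵖ C]
  {𝔇 : Coring B D} {ℭ : Coring A C}

/-- The descent datum `M ⊗_B A` of a `𝔇`-comodule `M`. -/
abbrev pushOutDesc (γ : CoringHom 𝔇 ℭ α) : Comod.{u} 𝔇 ⥤ DescentDatum.{u} γ :=
  pushOut.{u} α 𝔇 ⋙ comodToDesc γ

/-- The coaction of `N ⊗_B A` is the embedding `N → (N ⊗_B A) ⊗_B D` tensored with `A`. -/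
theorem pushOutDesc_ρ (γ : CoringHom 𝔇 ℭ α) (N : Comod.{u} 𝔇)
    (t : Tens (RingHom.id B) α N.carrier A) :
    ((pushOutDesc γ).obj N).ρ t =
      Tens.assoc _ _ _ _ _ D A (Tens.rTensorLin (RingHom.id B) α A (N.embed α) t) := by
  change collapse α _ _ (pushCoact α N t) = _
  induction t using Tens.induction_on with
  | pure n a =>
    rw [pushCoact_tmul, Tens.rTensorLin_tmul, Comod.embed, LinearMap.comp_apply]
    generalize N.coact n = s
    induction s using Tens.induction_on with
    | pure n d =>
      change Tens.tmul _ _ (Tens.tmul _ _ n ((1 : A) * 1)) (Tens.tmul _ _ d a) = _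
      rw [mul_one]; rfl
    | add x y hx hy => simp only [Tens.add_tmul, map_add, hx, hy]
  | add x y hx hy => simp only [map_add, hx, hy]

theorem DescentDatum.ρ_injective {γ : CoringHom 𝔇 ℭ α} (X : DescentDatum.{w} γ) :
    Function.Injective X.ρ :=
  Function.LeftInverse.injective X.contract_ρ

theorem Comod.embed_injective (γ : CoringHom 𝔇 ℭ α) (hA : IsLeftFaithfullyFlat α A)
    (N : Comod.{u} 𝔇) : Function.Injective (N.embed α) := by
  rw [hA.injective_iff]
  intro s t h
  apply ((pushOutDesc γ).obj N).ρ_injective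
  exact (pushOutDesc_ρ γ N s).trans ((congrArg _ h).trans (pushOutDesc_ρ γ N t).symm)

/-- A `𝔇`-comodule `N` is recovered from `N ⊗_B A` as the kernel of the defect. -/
theorem Comod.embed_exact (γ : CoringHom 𝔇 ℭ α) (hA : IsLeftFaithfullyFlat α A)
    (N : Comod.{u} 𝔇) : Function.Exact (N.embed α) ((pushOutDesc γ).obj N).defect := by
  refine (hA _ _ _ (N.embed α) ((pushOutDesc γ).obj N).defect).2 fun s => ?_
  refine (((pushOutDesc γ).obj N).rTensorLin_defect_eq_zero_iff s).trans ?_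
  refine exists_congr fun t => ?_
  rw [← Tens.assoc_injective.eq_iff]
  exact Eq.congr_left (pushOutDesc_ρ γ N t)

theorem insertComul_rTensorRight {X Y : Type*} [AddCommGroup X] [Module Aᵐᵒᵖ X]
    [AddCommGroup Y] [Module Aᵐᵒᵖ Y] (φ : X →ₗ[Aᵐᵒᵖ] Y) (t : Tens α (RingHom.id B) X D) :
    insertComul α 𝔇 Y (Tens.rTensorRight (Q := B) α (RingHom.id B) D φ t) =
      Tens.rTensorRight (Q := B) α (RingHom.id B) D
        (Tens.rTensorRight (Q := A) α (RingHom.id B) (Tens (RingHom.id B) α D A) φ)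
        (insertComul α 𝔇 X t) := by
  induction t using Tens.induction_on with
  | pure x d =>
    change insertOne α (φ x) (𝔇.comul.hom d) = Tens.rTensorRight (Q := B) α (RingHom.id B) D
        (Tens.rTensorRight (Q := A) α (RingHom.id B) (Tens (RingHom.id B) α D A) φ)
        (insertOne α x (𝔇.comul.hom d))
    generalize 𝔇.comul.hom d = s
    induction s using Tens.induction_on with
    | pure d e => rfl
    | add x y hx hy => simp only [map_add, hx, hy]
  | add x y hx hy => simp only [map_add, hx, hy]

/-- The defect is natural in the descent datum. -/
theorem DescentDatum.Hom.defect_comm {γ : CoringHom 𝔇 ℭ α} {X Y : DescentDatum.{w} γ}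
    (φ : X ⟶ Y) (t : Tens α (RingHom.id B) X.carrier D) :
    Y.defect (Tens.rTensorRight (Q := B) α (RingHom.id B) D φ.toLin t) =
      Tens.rTensorRight (Q := B) α (RingHom.id B) D
        (Tens.rTensorRight (Q := A) α (RingHom.id B) (Tens (RingHom.id B) α D A) φ.toLin)
        (X.defect t) := by
  rw [DescentDatum.defect, DescentDatum.defect, LinearMap.sub_apply, LinearMap.sub_apply, map_sub,
    insertComul_rTensorRight]
  congr 1
  induction t using Tens.induction_on with
  | pure x d => exact congrArg (fun y => Tens.tmul _ _ y d) (φ.comm x).symm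
  | add x y hx hy => simp only [map_add, hx, hy]

theorem Comod.embed_comm {M N : Comod.{u} 𝔇} (φ : M ⟶ N) (m : M.carrier) :
    N.embed α (φ.toLin m) =
      Tens.rTensorRight (Q := B) α (RingHom.id B) D (pushMap α φ.toLin) (M.embed α m) := by
  change unitInsert α N.carrier D (N.coact (φ.toLin m)) = _
  rw [← φ.comm, unitInsert_rTensorLin]; rfl

theorem pushOutDesc_faithful (γ : CoringHom 𝔇 ℭ α) (hA : IsLeftFaithfullyFlat α A) :
    (pushOutDesc γ).Faithful where
  map_injective {M N φ ψ} h := by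
    refine Comod.Hom.ext (LinearMap.ext fun m => Comod.embed_injective γ hA N ?_)
    have h' : pushMap α φ.toLin = pushMap α ψ.toLin := congrArg DescentDatum.Hom.toLin h
    rw [Comod.embed_comm, Comod.embed_comm, h']

theorem pushOutDesc_full (γ : CoringHom 𝔇 ℭ α) (hD : IsLeftFlat (RingHom.id B) D)
    (hA : IsLeftFaithfullyFlat α A) : (pushOutDesc γ).Full where
  map_surjective {M N} f := by
    let f' : Tens (RingHom.id B) α M.carrier A →ₗ[Aᵐᵒᵖ] Tens (RingHom.id B) α N.carrier A :=
      f.toLin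
    -- `f ⊗ D` maps the kernel `M` of the defect of `M ⊗ A` into the kernel `N` for `N ⊗ A`.
    let h : M.carrier →ₗ[Bᵐᵒᵖ] Tens α (RingHom.id B) (Tens (RingHom.id B) α N.carrier A) D :=
      Tens.rTensorRight (Q := B) α (RingHom.id B) D f' ∘ₗ M.embed α
    have hmem : ∀ m, ∃ n, N.embed α n = h m := fun m => by
      refine (Comod.embed_exact γ hA N (h m)).1 ((f.defect_comm (M.embed α m)).trans ?_)
      have h0 := (Comod.embed_exact γ hA M (M.embed α m)).2 ⟨m, rfl⟩
      exact (congrArg _ h0).trans (map_zero _)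
    obtain ⟨g, hg'⟩ := exists_comp_eq_of_injective (Comod.embed_injective γ hA N) h hmem
    have hg := LinearMap.congr_fun hg'
    refine ⟨⟨g, fun m => ?_⟩, DescentDatum.Hom.ext (LinearMap.ext fun t => ?_)⟩
    · apply hD _ _ (N.embed α) (Comod.embed_injective γ hA N)
      rw [← Tens.rTensorLin_comp, hg', Tens.rTensorLin_comp, Comod.rTensorLin_embed,
        Comod.rTensorLin_embed, ← cofreeCoact_rTensorLin]
      exact congrArg (cofreeCoact α 𝔇 _) (hg m).symm
    · change Tens.rTensorLin (RingHom.id B) α A g t = f' t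
      apply ((pushOutDesc γ).obj N).ρ_injective
      refine (pushOutDesc_ρ γ N _).trans (Eq.trans ?_ (f.comm t))
      have key : ∀ s : Tens (RingHom.id B) α M.carrier A,
          Tens.rTensorLin (RingHom.id B) α A (N.embed α) (Tens.rTensorLin (RingHom.id B) α A g s) =
            Tens.rTensorLin (RingHom.id B) α A (Tens.rTensorRight (Q := B) α (RingHom.id B) D f')
              (Tens.rTensorLin (RingHom.id B) α A (M.embed α) s) := fun s => by
        rw [← Tens.rTensorLin_comp, hg', Tens.rTensorLin_comp]
      refine (congrArg _ (key t)).trans ((assoc_rTensorRight f' _).trans ?_)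
      exact congrArg (Tens.rTensorLin α (RingHom.id B) _ f') (pushOutDesc_ρ γ M t).symm

end Descent

end CoringDescent

/-! ### Essential surjectivity of `- ⊗_B A` -/

namespace CoringDescent

section Cofree

variable {A B : Type*} [Ring A] [Ring B] {α : B →+* A}
  {D : Type*} [AddCommGroup D] [Module B D] [Module Bᵐᵒᵖ D] [SMulCommClass B Bᵐᵒᵖ D]
  {X : Type*} [AddCommGroup X] [Module Aᵐᵒᵖ X]

theorem cofreeCoact_coassoc (𝔇 : Coring B D) (t : Tens α (RingHom.id B) X D) :
    Tens.rTensorLin (RingHom.id B) (RingHom.id B) D (cofreeCoact α 𝔇 X)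
      (cofreeCoact α 𝔇 X t) =
    cofreeCoact (RingHom.id B) 𝔇 _ (cofreeCoact α 𝔇 X t) := by
  induction t using Tens.induction_on with
  | pure x d =>
    -- The map `(d₁ ⊗ d₂) ⊗ d₃ ↦ ((x ⊗ d₁) ⊗ d₂) ⊗ d₃`, to be applied to coassociativity.
    let G : Tens (RingHom.id B) (RingHom.id B) (Tens (RingHom.id B) (RingHom.id B) D D) D →+
        Tens (RingHom.id B) (RingHom.id B)
          (Tens (RingHom.id B) (RingHom.id B) (Tens α (RingHom.id B) X D) D) D :=
      Tens.rTensor D (AddMonoidHom.mk'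
        (fun s => Tens.assocInv α (RingHom.id B) (RingHom.id B) (RingHom.id B) X D D
          (Tens.tmul _ _ x s))
        (fun s s' => by rw [Tens.tmul_add, map_add]))
        (fun b s => by
          induction s using Tens.induction_on with
          | pure d e => rfl
          | add x y hx hy => simp only [smul_add, map_add, hx, hy])
    have h := congrArg (Tens.assocInv _ _ _ _ D D D) (𝔇.coassoc d)
    rw [Tens.assocInv_assoc] at h
    refine Eq.trans ?_ ((congrArg G h).trans ?_)
    · rw [cofreeCoact_tmul]
      generalize 𝔇.comul.hom d = s
      induction s using Tens.induction_on with
      | pure d e => rfl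
      | add x y hx hy => simp only [Tens.tmul_add, map_add, hx, hy]
    · rw [cofreeCoact_tmul]
      generalize 𝔇.comul.hom d = s
      induction s using Tens.induction_on with
      | pure d e =>
        change G (Tens.assocInv _ _ _ _ D D D (Tens.tmul _ _ d (𝔇.comul.hom e))) =
          Tens.assocInv _ _ _ _ _ D D (Tens.tmul _ _ (Tens.tmul _ _ x d) (𝔇.comul.hom e))
        generalize 𝔇.comul.hom e = s
        induction s using Tens.induction_on with
        | pure d e => rfl
        | add x y hx hy => simp only [Tens.tmul_add, map_add, hx, hy]
      | add x y hx hy => simp only [Tens.tmul_add, map_add, hx, hy]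
  | add x y hx hy => simp only [map_add, hx, hy]

theorem cofreeCoact_counit (𝔇 : Coring B D) (t : Tens α (RingHom.id B) X D) :
    Tens.mulRight (RingHom.id B) _ (Tens.lTensor _ 𝔇.counit.hom 𝔇.counit.map_left
      (cofreeCoact α 𝔇 X t)) = t := by
  induction t using Tens.induction_on with
  | pure x d =>
    rw [cofreeCoact_tmul]
    conv_rhs => rw [← 𝔇.counit_right d]
    generalize 𝔇.comul.hom d = s
    induction s using Tens.induction_on with
    | pure d e => rfl
    | add x y hx hy => simp only [Tens.tmul_add, map_add, hx, hy]
  | add x y hx hy => simp only [map_add, hx, hy]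

/-- `x ⊗ d ↦ ∑ (x ⊗ (d₁ ⊗ 1)) ⊗ d₂` is colinear. -/
theorem insertComul_cofreeCoact (𝔇 : Coring B D) (t : Tens α (RingHom.id B) X D) :
    Tens.rTensorLin (RingHom.id B) (RingHom.id B) D (insertComul α 𝔇 X)
      (cofreeCoact α 𝔇 X t) =
    cofreeCoact α 𝔇 _ (insertComul α 𝔇 X t) := by
  induction t using Tens.induction_on with
  | pure x d =>
    -- The map `(d₁ ⊗ d₂) ⊗ d₃ ↦ ((x ⊗ (d₁ ⊗ 1)) ⊗ d₂) ⊗ d₃`, to be applied to coassociativity.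
    let G : Tens (RingHom.id B) (RingHom.id B) (Tens (RingHom.id B) (RingHom.id B) D D) D →+
        Tens (RingHom.id B) (RingHom.id B) (Tens α (RingHom.id B)
          (Tens α (RingHom.id B) X (Tens (RingHom.id B) α D A)) D) D :=
      Tens.rTensor D (insertOne α x)
        (fun b s => by
          induction s using Tens.induction_on with
          | pure d e => rfl
          | add x y hx hy => simp only [smul_add, map_add, hx, hy])
    have h := congrArg (Tens.assocInv _ _ _ _ D D D) (𝔇.coassoc d)
    rw [Tens.assocInv_assoc] at h
    refine Eq.trans ?_ ((congrArg G h).trans ?_)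
    · rw [cofreeCoact_tmul]
      generalize 𝔇.comul.hom d = s
      induction s using Tens.induction_on with
      | pure d e => rfl
      | add x y hx hy => simp only [Tens.tmul_add, map_add, hx, hy]
    · rw [insertComul_tmul]
      generalize 𝔇.comul.hom d = s
      induction s using Tens.induction_on with
      | pure d e =>
        change G (Tens.assocInv _ _ _ _ D D D (Tens.tmul _ _ d (𝔇.comul.hom e))) =
          Tens.assocInv _ _ _ _ _ D D
            (Tens.tmul _ _ (Tens.tmul _ _ x (Tens.tmul _ _ d 1)) (𝔇.comul.hom e))
        generalize 𝔇.comul.hom e = s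
        induction s using Tens.induction_on with
        | pure d e => rfl
        | add x y hx hy => simp only [Tens.tmul_add, map_add, hx, hy]
      | add x y hx hy => simp only [map_add, hx, hy]
  | add x y hx hy => simp only [map_add, hx, hy]

theorem map_mulRight_counit (𝔇 : Coring B D) {M N : Type*} [AddCommGroup M] [Module Bᵐᵒᵖ M]
    [AddCommGroup N] [Module Bᵐᵒᵖ N] (φ : M →ₗ[Bᵐᵒᵖ] N)
    (s : Tens (RingHom.id B) (RingHom.id B) M D) :
    φ (Tens.mulRight (RingHom.id B) M
      (Tens.lTensor M 𝔇.counit.hom 𝔇.counit.map_left s)) =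
    Tens.mulRight (RingHom.id B) N (Tens.lTensor N 𝔇.counit.hom 𝔇.counit.map_left
      (Tens.rTensorLin (RingHom.id B) (RingHom.id B) D φ s)) := by
  induction s using Tens.induction_on with
  | pure m d => exact φ.map_smul _ _
  | add x y hx hy => simp only [map_add, hx, hy]

/-- The map `X ⊗_B D → X`, `x ⊗ d ↦ x · ε(d)`. -/
def applyCounit (α : B →+* A) (𝔇 : Coring B D) (X : Type*) [AddCommGroup X] [Module Aᵐᵒᵖ X] :
    Tens α (RingHom.id B) X D →+ X :=
  Tens.lift (fun x d => op (α (𝔇.counit.hom d)) • x)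
    (fun x y d => smul_add _ _ _)
    (fun x d e => by rw [map_add, map_add, MulOpposite.op_add, add_smul])
    (fun b x d => by
      rw [𝔇.counit.map_left, smul_eq_mul, map_mul, op_mul, mul_smul]; rfl)

theorem applyCounit_smul (𝔇 : Coring B D) (b : B) (t : Tens α (RingHom.id B) X D) :
    applyCounit α 𝔇 X (op (RingHom.id B b) • t) = op (α b) • applyCounit α 𝔇 X t := by
  induction t using Tens.induction_on with
  | pure x d =>
    change op (α (𝔇.counit.hom (op b • d))) • x = op (α b) • op (α (𝔇.counit.hom d)) • x
    rw [𝔇.counit.map_right, smul_smul, ← op_mul, ← map_mul]; rfl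
  | add x y hx hy => simp only [smul_add, map_add, hx, hy]

theorem contract_assoc_tmul (𝔇 : Coring B D) (t : Tens α (RingHom.id B) X D) (a : A) :
    contract α 𝔇 X (Tens.assoc _ _ _ _ X D A (Tens.tmul _ _ t a)) =
      op a • applyCounit α 𝔇 X t := by
  induction t using Tens.induction_on with
  | pure x d =>
    rw [Tens.assoc_tmul, contract_tmul, op_mul, mul_smul]; rfl
  | add x y hx hy => simp only [Tens.add_tmul, smul_add, map_add, hx, hy]

theorem applyCounit_cofreeCoact (𝔇 : Coring B D) (t : Tens α (RingHom.id B) X D) :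
    Tens.rTensor (f := RingHom.id B) (g := RingHom.id B) D (applyCounit α 𝔇 X)
      (applyCounit_smul 𝔇) (cofreeCoact α 𝔇 X t) = t := by
  induction t using Tens.induction_on with
  | pure x d =>
    rw [cofreeCoact_tmul]
    conv_rhs => rw [← 𝔇.counit_left d]
    generalize 𝔇.comul.hom d = s
    induction s using Tens.induction_on with
    | pure d e => exact Tens.smul_tmul (f := α) (g := RingHom.id B) (𝔇.counit.hom d) x e
    | add x y hx hy => simp only [Tens.tmul_add, map_add, hx, hy]
  | add x y hx hy => simp only [map_add, hx, hy]

end Cofree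

section Coinvariants

variable {A B D : Type u} [Ring A] [Ring B] {α : B →+* A}
  [AddCommGroup D] [Module B D] [Module Bᵐᵒᵖ D] [SMulCommClass B Bᵐᵒᵖ D]
  {C : Type v} [AddCommGroup C] [Module A C] [Module Aᵐᵒᵖ C] [SMulCommClass A Aᵐᵒᵖ C]
  {𝔇 : Coring B D} {ℭ : Coring A C} {γ : CoringHom 𝔇 ℭ α}

/-- As `D` is flat, the coaction of `X ⊗_B D` restricts to the kernel of the defect, which is
thereby a `𝔇`-comodule. -/
theorem DescentDatum.exists_comod_ker_defect (hD : IsLeftFlat (RingHom.id B) D)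
    (X : DescentDatum.{u} γ) :
    ∃ (M : Comod.{u} 𝔇) (i : M.carrier →ₗ[Bᵐᵒᵖ] Tens α (RingHom.id B) X.carrier D),
      Function.Injective i ∧ Function.Exact i X.defect ∧
      ∀ m, Tens.rTensorLin (RingHom.id B) (RingHom.id B) D i (M.coact m) =
        cofreeCoact α 𝔇 X.carrier (i m) := by
  let K := LinearMap.ker X.defect
  let ι : Tens (RingHom.id B) (RingHom.id B) K D →ₗ[Bᵐᵒᵖ]
      Tens (RingHom.id B) (RingHom.id B) (Tens α (RingHom.id B) X.carrier D) D :=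
    Tens.rTensorRight (Q := B) (RingHom.id B) (RingHom.id B) D K.subtype
  have hι : Function.Injective ι := hD _ _ K.subtype Subtype.val_injective
  have hmem : ∀ k : K, ∃ s, ι s = (cofreeCoact α 𝔇 X.carrier ∘ₗ K.subtype) k := fun k => by
    refine hD.exact_ker X.defect ?_
    rw [DescentDatum.defect, Tens.rTensorLin_sub, LinearMap.comp_apply, insertComul_cofreeCoact,
      ← cofreeCoact_rTensorLin, ← map_sub]
    exact (congrArg _ k.2).trans (map_zero _)
  obtain ⟨c, hc'⟩ := exists_comp_eq_of_injective hι _ hmem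
  have hc : ∀ k : K, Tens.rTensorLin (RingHom.id B) (RingHom.id B) D K.subtype (c k) =
    cofreeCoact α 𝔇 X.carrier k := LinearMap.congr_fun hc'
  refine ⟨⟨K, c, fun k => ?_, fun k => ?_⟩, K.subtype, Subtype.val_injective,
    LinearMap.exact_subtype_ker_map X.defect, hc⟩
  · refine Eq.trans (congrArg (Tens.assoc _ _ _ _ K D D) ?_)
      (Tens.assoc_assocInv (Tens.lTensor K 𝔇.comul.hom 𝔇.comul.map_left (c k)))
    change _ = cofreeCoact (RingHom.id B) 𝔇 K (c k)
    apply hD _ _ ι hι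
    rw [← Tens.rTensorLin_comp, hc', Tens.rTensorLin_comp, ← cofreeCoact_rTensorLin]
    change Tens.rTensorLin _ _ _ _ (Tens.rTensorLin _ _ _ K.subtype (c k)) =
      cofreeCoact _ _ _ (Tens.rTensorLin _ _ _ K.subtype (c k))
    rw [hc, cofreeCoact_coassoc]
  · apply Subtype.val_injective
    refine (map_mulRight_counit 𝔇 K.subtype (c k)).trans ?_
    rw [hc, cofreeCoact_counit]

theorem DescentDatum.Hom.isIso_of_bijective {γ : CoringHom 𝔇 ℭ α} {X Y : DescentDatum.{w} γ}
    (φ : X ⟶ Y) (h : Function.Bijective φ.toLin) : IsIso φ := by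
  let e := LinearEquiv.ofBijective φ.toLin h
  have he : e.symm.toLinearMap ∘ₗ φ.toLin = LinearMap.id :=
    LinearMap.ext fun x => e.symm_apply_apply x
  refine ⟨⟨e.symm.toLinearMap, fun y => ?_⟩, ?_, ?_⟩
  · obtain ⟨x, rfl⟩ := h.2 y
    rw [← φ.comm, ← Tens.rTensorLin_comp, he, Tens.rTensorLin_id]
    exact congrArg X.ρ (e.symm_apply_apply x).symm
  · exact DescentDatum.Hom.ext he
  · exact DescentDatum.Hom.ext (LinearMap.ext fun y => e.apply_symm_apply y)

theorem pushOutDesc_essSurj (γ : CoringHom 𝔇 ℭ α) (hD : IsLeftFlat (RingHom.id B) D)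
    (hA : IsLeftFaithfullyFlat α A) : (pushOutDesc γ).EssSurj where
  mem_essImage X := by
    obtain ⟨M, i, hi, hK, hc⟩ := X.exists_comod_ker_defect hD
    -- The candidate isomorphism `m ⊗ a ↦ x · (ε(d) a)`, where `i m = x ⊗ d`.
    let Φ : Tens (RingHom.id B) α M.carrier A →ₗ[Aᵐᵒᵖ] X.carrier :=
      { ((contract α 𝔇 X.carrier).comp (Tens.assoc _ _ _ _ X.carrier D A)).comp
          (Tens.rTensorLin (RingHom.id B) α A i) with
        map_smul' := fun a s => by
          change contract _ _ _ (Tens.assoc _ _ _ _ X.carrier D A (Tens.rTensorLin _ _ _ _ _)) =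
            a • contract _ _ _ (Tens.assoc _ _ _ _ X.carrier D A (Tens.rTensorLin _ _ _ _ _))
          induction s using Tens.induction_on with
          | pure k b =>
            change contract _ _ _ (Tens.assoc _ _ _ _ X.carrier D A (Tens.tmul _ _ (i k) (b * unop a)))
              = a • contract _ _ _ (Tens.assoc _ _ _ _ X.carrier D A (Tens.tmul _ _ (i k) b))
            rw [contract_assoc_tmul, contract_assoc_tmul, smul_smul, op_mul, op_unop]
          | add x y hx hy => simp only [smul_add, map_add, hx, hy] }
    have hKA := (hA _ _ _ _ _).1 hK
    have hρ : ∀ s, X.ρ (Φ s) =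
        Tens.assoc _ _ _ _ X.carrier D A (Tens.rTensorLin (RingHom.id B) α A i s) := by
      intro s
      obtain ⟨x, hx⟩ := (X.rTensorLin_defect_eq_zero_iff _).1 ((hKA _).2 ⟨s, rfl⟩)
      change X.ρ (contract _ _ _ _) = _
      rw [← hx, X.contract_ρ]
    have hΦ : Function.Bijective Φ := by
      constructor
      · intro s t h
        apply (hA.injective_iff i).1 hi
        apply Tens.assoc_injective
        rw [← hρ, ← hρ, h]
      · intro x
        obtain ⟨s, hs⟩ := (hKA (Tens.assocInv _ _ _ _ X.carrier D A (X.ρ x))).1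
          ((X.rTensorLin_defect_eq_zero_iff _).2 ⟨x, (Tens.assoc_assocInv _).symm⟩)
        refine ⟨s, X.ρ_injective ?_⟩
        rw [hρ, hs, Tens.assoc_assocInv]
    -- `Φ ⊗ D` undoes the embedding `M → (M ⊗ A) ⊗ D` up to `i`, by the counit axiom of `𝔇`.
    have hembed : Tens.rTensorRight (Q := B) α (RingHom.id B) D Φ ∘ₗ M.embed α = i := by
      refine LinearMap.ext fun k => ?_
      refine Eq.trans ?_ (applyCounit_cofreeCoact 𝔇 (i k))
      rw [← hc]
      change Tens.rTensorRight (Q := B) α (RingHom.id B) D Φ (unitInsert α M.carrier D (M.coact k)) = _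
      generalize M.coact k = s
      induction s using Tens.induction_on with
      | pure l d =>
        refine congrArg (fun x => Tens.tmul α (RingHom.id B) x d) ?_
        refine (contract_assoc_tmul 𝔇 (i l) 1).trans ?_
        rw [op_one, one_smul]; rfl
      | add x y hx hy => simp only [map_add, hx, hy]
    let φ : (pushOutDesc γ).obj M ⟶ X := ⟨Φ, fun s => by
      refine (congrArg (Tens.rTensorLin α (RingHom.id B) _ Φ) (pushOutDesc_ρ γ M s)).trans ?_
      refine (assoc_rTensorRight Φ _).symm.trans ((congrArg _ ?_).trans (hρ s).symm)
      rw [← hembed]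
      exact (Tens.rTensorLin_comp _ _ _ _ _ _).symm⟩
    have : IsIso φ := φ.isIso_of_bijective hΦ
    exact ⟨M, ⟨asIso φ⟩⟩

end Coinvariants

end CoringDescent

/-- `Desc_(γ,α)` is isomorphic, as a category, to the category of right `A_α[𝔇]`-comodules; and
if `D` is left `B`-flat and `A` is left faithfully flat over `B`, then `- ⊗_B A` is an equivalence
from right `𝔇`-comodules to right `A_α[𝔇]`-comodules, and to `Desc_(γ,α)`. -/
theorem lemma5p4 {k : Type*} [CommRing k] {A B D : Type u} {C : Type v}
    [Ring A] [Ring B] [Algebra k A] [Algebra k B]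
    [AddCommGroup D] [Module B D] [Module Bᵐᵒᵖ D] [SMulCommClass B Bᵐᵒᵖ D]
    [AddCommGroup C] [Module A C] [Module Aᵐᵒᵖ C] [SMulCommClass A Aᵐᵒᵖ C]
    (𝔇 : Coring B D) (ℭ : Coring A C) (α : B →ₐ[k] A) (γ : CoringHom 𝔇 ℭ α.toRingHom) :
    (∃ G : DescentDatum.{w} γ ⥤ Comod.{w} (𝔇.baseExt α.toRingHom),
      G ⋙ comodToDesc γ = 𝟭 (DescentDatum.{w} γ) ∧
      comodToDesc γ ⋙ G = 𝟭 (Comod.{w} (𝔇.baseExt α.toRingHom))) ∧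
    (IsLeftFlat (RingHom.id B) D → IsLeftFaithfullyFlat α.toRingHom A →
      (pushOut.{u} α.toRingHom 𝔇).IsEquivalence ∧
      (pushOut.{u} α.toRingHom 𝔇 ⋙ comodToDesc γ).IsEquivalence) := by

  refine ⟨⟨descToComod γ, descToComod_comp_comodToDesc γ, comodToDesc_comp_descToComod γ⟩,
    fun hD hA => ?_⟩
  have h1 := comodToDesc_isEquivalence.{u} γ
  have h2 : (pushOut.{u} α.toRingHom 𝔇 ⋙ comodToDesc γ).IsEquivalence :=
    { faithful := pushOutDesc_faithful γ hA
      full := pushOutDesc_full γ hD hA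
      essSurj := pushOutDesc_essSurj γ hD hA }
  exact ⟨Functor.isEquivalence_of_comp_right _ (comodToDesc γ), h2⟩
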